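/- **Conventions.** $\mathbf R^n$ carries its standard diffeology; $I=[0,1]$, $I^n\subset\mathbf R^n$ and $\partial I^n$ (the points of $I^n$ having some coordinate in $\{0,1\}$; so $\partial I^0=\emptyset$) carry the subspace diffeology; products, coproducts and quotients of diffeological spaces carry the product, coproduct and quotient diffeologies. A smooth map $f\colon\partial I^n\to X$ to a diffeological space is *tame* if for some $0<\epsilon\le 1/2$ the following holds: whenever $t\in\partial I^n$, $\alpha\in\{0,1\}$ and $|t_j-\alpha|\le\epsilon$, the value $f(t)$ does not change when $t_j$ is replaced by $\alpha$. A *tame homotopy* is a smooth map $F\colon X\times I\to Y$ such that, for some $0<\epsilon\le1/2$, $F(x,t)=F(x,\alpha)$ for all $x\in X$, $\alpha\in\{0,1\}$ and $t\in I$ with $|t-\alpha|\le\epsilon$. A *smooth relative CW complex* $(X,A)$ is a diffeological space $X$ with a subspace $A$ and a sequence of inclusions $A=X^{-1}\subset X^0\subset X^1\subset\cdots$ of subspaces of $X$ such that $X$ is the colimit of the $X^n$ in the category of diffeological spaces, and for each $n\ge0$ there are a set $\Lambda_n$, attaching maps $\phi_\lambda\colon\partial I^n\to X^{n-1}$ and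 characteristic maps $\Phi_\lambda\colon I^n\to X^n$ $(\lambda\in\Lambda_n)$ exhibiting $X^n$ as the pushout of $X^{n-1}\xleftarrow{\ \bigcup\phi_\lambda\ }\coprod_{\lambda}\partial I^n\hookrightarrow\coprod_{\lambda}I^n$ in the category of diffeological spaces. It is *gathered* if all attaching maps are tame, and has *dimension $\le N$* if $X=X^N$. For a diffeological space $X$ and $x_0\in X$, $\pi_n(X,x_0)$ $(n\ge0)$ is the set of homotopy classes of smooth maps of pairs $(I^n,\partial I^n)\to(X,x_0)$, where homotopies are smooth maps $I^n\times I\to X$ sending $\partial I^n\times I$ to $x_0$. A smooth map $p\colon Y\to Z$ is an *$N$-equivalence* if for every $y\in Y$ the induced map $p_*\colon\pi_n(Y,y)\to\pi_n(Z,p(y))$ is injective for $0\le n<N$ and surjective for $0\le n\le N$. **Theorem (Homotopy extension lifting property).** Let $N\ge0$ be an integer, let $(X,A)$ be a gathered smooth relative CW complex of dimension $\le N$, and let $p\colon Y\to Z$ be an $N$-equivalence of diffeological spaces, where $Y\neq\emptyset$ unless $Z=\emptyset$. Given smooth maps $f'\colon A\to Y$ and $g\colon X\to Z$ and a tame homotopy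 $F'\colon A\times I\to Z$ with $F'(a,0)=g(a)$ and $F'(a,1)=p(f'(a))$ for all $a\in A$, there exist a smooth map $f\colon X\to Y$ and a tame homotopy $G\colon X\times I\to Z$ such that $f|_A=f'$, $G|_{A\times I}=F'$, and $G(x,0)=g(x)$ and $G(x,1)=p(f(x))$ for all $x\in X$. -/

import Mathlib

open Diffeology

universe u v w c

namespace SmoothCW

/-! ### Subspaces, products, coproducts and quotients of diffeological spaces -/

/-- The diffeology on `X` induced by `f : X → Y`: the plots are the maps that become plots
after composition with `f`. -/
abbrev induced {X : Type u} {Y : Type v} (f : X → Y) (d : DiffeologicalSpace Y) :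
    DiffeologicalSpace X where
  plots _ := {p | IsPlot (f ∘ p)}
  constant_plots x := isPlot_const (x := f x)
  plot_reparam {_ _ p _} hp hf := isPlot_reparam (p := f ∘ p) hp hf
  locality hp := d.locality hp

/-- The final diffeology on `Y` defined by `f : X → Y`. -/
abbrev coinduced {X : Type u} {Y : Type v} (f : X → Y) (d : DiffeologicalSpace X) :
    DiffeologicalSpace Y :=
  DiffeologicalSpace.generateFrom
    {q | ∃ (n : ℕ) (p : EuclideanSpace ℝ (Fin n) → X), IsPlot p ∧ q = ⟨n, f ∘ p⟩}

/-- The subspace diffeology. -/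
instance instSubtype {X : Type u} [d : DiffeologicalSpace X] {P : X → Prop} :
    DiffeologicalSpace (Subtype P) :=
  induced Subtype.val d

/-- The product diffeology. -/
instance instProd {X : Type u} {Y : Type v} [dX : DiffeologicalSpace X]
    [dY : DiffeologicalSpace Y] : DiffeologicalSpace (X × Y) :=
  induced Prod.fst dX ⊓ induced Prod.snd dY

/-- The coproduct diffeology of two spaces. -/
instance instSum {X : Type u} {Y : Type v} [dX : DiffeologicalSpace X]
    [dY : DiffeologicalSpace Y] : DiffeologicalSpace (X ⊕ Y) :=
  coinduced Sum.inl dX ⊔ coinduced Sum.inr dY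

/-- The coproduct diffeology of a family of spaces. -/
instance instSigma {ι : Type u} {X : ι → Type v} [d : ∀ i, DiffeologicalSpace (X i)] :
    DiffeologicalSpace (Σ i, X i) :=
  ⨆ i, coinduced (Sigma.mk i) (d i)

/-- The quotient diffeology, for the equivalence relation generated by `r`. -/
instance instQuot {X : Type u} [d : DiffeologicalSpace X] {r : X → X → Prop} :
    DiffeologicalSpace (Quot r) :=
  coinduced (Quot.mk r) d

/-- A bijection that is smooth in both directions. -/
def IsDiffeomorphism {X : Type u} {Y : Type v} [DiffeologicalSpace X] [DiffeologicalSpace Y]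
    (e : X ≃ Y) : Prop :=
  DSmooth e ∧ DSmooth e.symm

/-! ### Pushouts and sequential colimits -/

/-- The gluing relation `f s ∼ i s` on the coproduct of `B` and `T`. -/
inductive PushoutRel {S : Type*} {B : Type*} {T : Type*} (f : S → B) (i : S → T) :
    B ⊕ T → B ⊕ T → Prop
  | glue (s : S) : PushoutRel f i (Sum.inl (f s)) (Sum.inr (i s))

/-- The pushout of `B ← S → T`, with the quotient diffeology of the coproduct. -/
abbrev Pushout {S : Type*} {B : Type*} {T : Type*} (f : S → B) (i : S → T) : Type _ :=
  Quot (PushoutRel f i)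

/-- The square with sides `f : S → B`, `i : S → T`, `j : B → P`, `g : T → P` is a pushout square
of diffeological spaces: `P`, with the maps `j` and `g`, is diffeomorphic to the pushout. -/
def IsPushoutSquare {S : Type*} {B : Type*} {T : Type*} {P : Type*}
    [DiffeologicalSpace S] [DiffeologicalSpace B] [DiffeologicalSpace T] [DiffeologicalSpace P]
    (f : S → B) (i : S → T) (j : B → P) (g : T → P) : Prop :=
  DSmooth f ∧ DSmooth i ∧
    ∃ e : Pushout f i ≃ P, IsDiffeomorphism e ∧
      (∀ b, e (Quot.mk _ (Sum.inl b)) = j b) ∧ (∀ t, e (Quot.mk _ (Sum.inr t)) = g t)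

/-- The relation on the coproduct of a sequence identifying a point with its image in the
next space. -/
inductive SeqColimRel {X : ℕ → Type*} (i : ∀ n, X n → X (n + 1)) :
    (Σ n, X n) → (Σ n, X n) → Prop
  | glue (n : ℕ) (x : X n) : SeqColimRel i ⟨n, x⟩ ⟨n + 1, i n x⟩

/-- The colimit of a sequence of spaces, with the quotient diffeology of the coproduct. -/
abbrev SeqColim {X : ℕ → Type*} (i : ∀ n, X n → X (n + 1)) : Type _ :=
  Quot (SeqColimRel i)

/-! ### Cubes and tameness -/

/-- The cube `I^n` in `ℝ^n`. -/
def cube (n : ℕ) : Set (EuclideanSpace ℝ (Fin n)) :=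
  {t | ∀ j, 0 ≤ t j ∧ t j ≤ 1}

/-- The boundary of the cube `I^n`. -/
def cubeBoundary (n : ℕ) : Set (EuclideanSpace ℝ (Fin n)) :=
  {t | t ∈ cube n ∧ ∃ j, t j = 0 ∨ t j = 1}

theorem cubeBoundary_subset (n : ℕ) : cubeBoundary n ⊆ cube n := fun _ h => h.1

/-- `ε`-tameness of a map defined on a cubical subcomplex `K` of `I^n`: moving a coordinate that
is at distance at most `ε` from `α ∈ {0, 1}` to `α` does not change the value. -/
def IsEpsTame {n : ℕ} {K : Set (EuclideanSpace ℝ (Fin n))} {X : Type u} (ε : ℝ) (f : K → X) :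
    Prop :=
  ∀ (j : Fin n) (α : ℝ), (α = 0 ∨ α = 1) → ∀ t s : K,
    |t.1 j - α| ≤ ε → s.1 j = α → (∀ k, k ≠ j → s.1 k = t.1 k) → f t = f s

/-- A tame map on a cubical subcomplex `K` of `I^n`. -/
def IsTame {n : ℕ} {K : Set (EuclideanSpace ℝ (Fin n))} {X : Type u} [DiffeologicalSpace X]
    (f : K → X) : Prop :=
  DSmooth f ∧ ∃ ε : ℝ, 0 < ε ∧ ε ≤ 1 / 2 ∧ IsEpsTame ε f

/-- A tame homotopy: a smooth map `X × I → Y` that is stationary near both ends, for a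
distance that does not depend on the point of `X`. -/
def IsTameHomotopy {X : Type u} {Y : Type v} [DiffeologicalSpace X] [DiffeologicalSpace Y]
    (F : X × unitInterval → Y) : Prop :=
  DSmooth F ∧ ∃ ε : ℝ, 0 < ε ∧ ε ≤ 1 / 2 ∧
    ∀ (x : X) (t α : unitInterval), (α = 0 ∨ α = 1) →
      |(t : ℝ) - (α : ℝ)| ≤ ε → F (x, t) = F (x, α)

/-! ### Smooth relative CW complexes -/

/-- The structure of a smooth relative CW complex on the pair `(X, A)`. The skeleta are indexed
with a shift: `skel n` is the skeleton of dimension `n - 1`, so that `skel 0 = A`. The cells in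
`cell n` have dimension `n`. Skeleta carry the subspace diffeology. -/
structure RelCWComplex (X : Type u) [DiffeologicalSpace X] (A : Set X) where
  /-- `skel n` is the skeleton of dimension `n - 1`. -/
  skel : ℕ → Set X
  skel_zero : skel 0 = A
  skel_subset : ∀ n, skel n ⊆ skel (n + 1)
  /-- The index set of the `n`-cells. -/
  cell : ℕ → Type v
  /-- The attaching maps. -/
  attach : ∀ n, cell n → cubeBoundary n → skel n
  /-- The characteristic maps. -/
  char : ∀ n, cell n → cube n → skel (n + 1)
  /-- The skeleton of dimension `n` is obtained from the previous one by attaching the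
  `n`-cells. -/
  isPushout : ∀ n, IsPushoutSquare
    (fun x : Σ _ : cell n, cubeBoundary n => attach n x.1 x.2)
    (fun x : Σ _ : cell n, cubeBoundary n =>
      (⟨x.1, Set.inclusion (cubeBoundary_subset n) x.2⟩ : Σ _ : cell n, cube n))
    (Set.inclusion (skel_subset n))
    (fun x : Σ _ : cell n, cube n => char n x.1 x.2)
  /-- `X` is the colimit of its skeleta. -/
  isColimit : ∃ e : SeqColim (fun n => Set.inclusion (skel_subset n)) ≃ X,
    IsDiffeomorphism e ∧ ∀ n (x : skel n), e (Quot.mk _ ⟨n, x⟩) = x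

/-- All attaching maps are tame. -/
def RelCWComplex.IsGathered {X : Type u} [DiffeologicalSpace X] {A : Set X}
    (C : RelCWComplex.{u, v} X A) : Prop :=
  ∀ n (c : C.cell n), IsTame (C.attach n c)

/-- The dimension is at most `N`, that is, the `N`-skeleton is all of `X`. -/
def RelCWComplex.DimLE {X : Type u} [DiffeologicalSpace X] {A : Set X}
    (C : RelCWComplex.{u, v} X A) (N : ℕ) : Prop :=
  C.skel (N + 1) = Set.univ

/-! ### Smooth homotopy groups and `N`-equivalences -/

/-- Smooth maps of pairs `(I^n, ∂I^n) → (X, x₀)`. -/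
def CubeMap (n : ℕ) (X : Type u) [DiffeologicalSpace X] (x₀ : X) : Type u :=
  {f : cube n → X // DSmooth f ∧ ∀ t : cube n, t.1 ∈ cubeBoundary n → f t = x₀}

/-- Smooth homotopy of maps of pairs `(I^n, ∂I^n) → (X, x₀)`. -/
def CubeMap.Homotopic {n : ℕ} {X : Type u} [DiffeologicalSpace X] {x₀ : X}
    (f₀ f₁ : CubeMap n X x₀) : Prop :=
  ∃ H : cube n × unitInterval → X, DSmooth H ∧
    (∀ t, H (t, 0) = f₀.1 t) ∧ (∀ t, H (t, 1) = f₁.1 t) ∧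
    ∀ (t : cube n) (s : unitInterval), t.1 ∈ cubeBoundary n → H (t, s) = x₀

/-- The smooth homotopy set `π_n(X, x₀)`, the homotopy classes of smooth maps of pairs
`(I^n, ∂I^n) → (X, x₀)`. -/
def HomotopyClasses (n : ℕ) (X : Type u) [DiffeologicalSpace X] (x₀ : X) : Type u :=
  Quot (CubeMap.Homotopic (n := n) (x₀ := x₀))

/-- The map `π_n(X, x₀) → π_n(Y, φ x₀)` induced by a smooth map `φ`. -/
def HomotopyClasses.map {X : Type u} {Y : Type v} [DiffeologicalSpace X] [DiffeologicalSpace Y]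
    {φ : X → Y} (hφ : DSmooth φ) (n : ℕ) (x₀ : X) :
    HomotopyClasses n X x₀ → HomotopyClasses n Y (φ x₀) :=
  Quot.map
    (fun f => ⟨φ ∘ f.1, hφ.comp f.2.1, fun t ht => congrArg φ (f.2.2 t ht)⟩)
    (fun _ _ ⟨H, hH, h₀, h₁, hb⟩ => ⟨φ ∘ H, hφ.comp hH, fun t => congrArg φ (h₀ t),
      fun t => congrArg φ (h₁ t), fun t s ht => congrArg φ (hb t s ht)⟩)

/-- A smooth map is an `N`-equivalence if, for every base point, it is injective on `π_n` for
`0 ≤ n < N` and surjective on `π_n` for `0 ≤ n ≤ N`. -/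
structure IsNEquivalence {X : Type u} {Y : Type v} [DiffeologicalSpace X] [DiffeologicalSpace Y]
    (N : ℕ) (φ : X → Y) : Prop where
  smooth : DSmooth φ
  injective : ∀ (x : X) (n : ℕ), n < N → Function.Injective (HomotopyClasses.map smooth n x)
  surjective : ∀ (x : X) (n : ℕ), n ≤ N → Function.Surjective (HomotopyClasses.map smooth n x)

end SmoothCW

namespace SmoothCW

open scoped ContDiff Topology

/-! ### Plots, and smooth maps out of normed spaces -/

/-! The extension is built over one skeleton at a time, cell by cell. For a single cell the problem
is this: a cube in `Z` is given, together with a lift to `Y` of its boundary up to a homotopy, and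
both the lift and the homotopy must be extended over the cube. As in topology this comes from
filling open boxes. Filling carries the homotopy inwards (`exists_fill`). Injectivity on homotopy
sets below dimension `N` extends the boundary lift to some cube (`TameHomotopic.of_comp`,
`exists_extension`). Surjectivity up to dimension `N` corrects that cube so that its image is
homotopic to the given one (`exists_lift`, `exists_extension_lift`).

Smooth data on adjacent faces do not glue in general, but tame data do: they do not vary in the
collar directions near a face, so they extend constantly across the collars. A tame cube is
therefore modelled as a map on all of `ℝⁿ` that is invariant under the discontinuous collapse
`snap`, and the smooth map `flat` makes cubes tame without changing those already tame enough. Box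
filling also makes tame homotopy relative to the boundary an equivalence relation, which allows
comparison with the smooth homotopy classes.

Three points are specific to complexes. The map `g` need not be tame on a cell, so it is first
deformed to its flattening along line segments; tameness of the attaching map keeps this deformation
constant on the boundary. The tameness of the attaching maps may vary from cell to cell, whereas a
tame homotopy needs one collar in time for all cells; `exists_cell_extension` shrinks that collar by
a factor independent of the cell, and only finitely many dimensions occur. Finally, maps out of the
product of a pushout with the interval must be recognised as smooth
(`IsPushoutSquare.dSmooth_prod`). -/

theorem isPlot_of_eventuallyEq {X : Type*} [DiffeologicalSpace X] {n : ℕ}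
    {p : EuclideanSpace ℝ (Fin n) → X}
    (h : ∀ x, ∃ q : EuclideanSpace ℝ (Fin n) → X, IsPlot q ∧ p =ᶠ[𝓝 x] q) : IsPlot p := by
  refine DiffeologicalSpace.locality fun x => ?_
  obtain ⟨q, hq, hpq⟩ := h x
  obtain ⟨U, hU, hUo, hxU⟩ := mem_nhds_iff.1 hpq
  refine ⟨U, hUo, hxU, fun {m f} hf hfs => ?_⟩
  have : p ∘ f = q ∘ f := funext fun y => hU (hf y)
  rw [this]
  exact isPlot_reparam hq hfs

theorem isPlot_prod_iff {X Y : Type*} [DiffeologicalSpace X] [DiffeologicalSpace Y] {n : ℕ}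
    {p : EuclideanSpace ℝ (Fin n) → X × Y} :
    IsPlot p ↔ IsPlot (fun x => (p x).1) ∧ IsPlot (fun x => (p x).2) :=
  DiffeologicalSpace.isPlot_inf_iff

theorem isPlot_subtype_iff {X : Type*} [DiffeologicalSpace X] {P : X → Prop} {n : ℕ}
    {p : EuclideanSpace ℝ (Fin n) → Subtype P} :
    IsPlot p ↔ IsPlot (fun x => (p x).1) :=
  Iff.rfl

theorem dSmooth_subtype_val {X : Type*} [DiffeologicalSpace X] {P : X → Prop} :
    DSmooth (Subtype.val : Subtype P → X) := fun _ _ h => h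

theorem dSmooth_inclusion {X : Type*} [DiffeologicalSpace X] {s t : Set X} (h : s ⊆ t) :
    DSmooth (Set.inclusion h) := fun _ _ h => h

theorem dSmooth_prodMk {W X Y : Type*} [DiffeologicalSpace W] [DiffeologicalSpace X]
    [DiffeologicalSpace Y] {f : W → X} {g : W → Y} (hf : DSmooth f) (hg : DSmooth g) :
    DSmooth fun x => (f x, g x) :=
  fun n p hp => isPlot_prod_iff.2 ⟨hf n p hp, hg n p hp⟩

theorem dSmooth_fst {X Y : Type*} [DiffeologicalSpace X] [DiffeologicalSpace Y] :
    DSmooth (Prod.fst : X × Y → X) := fun _ _ hp => (isPlot_prod_iff.1 hp).1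

theorem dSmooth_snd {X Y : Type*} [DiffeologicalSpace X] [DiffeologicalSpace Y] :
    DSmooth (Prod.snd : X × Y → Y) := fun _ _ hp => (isPlot_prod_iff.1 hp).2

/-- A map from a normed space to a diffeological space is smooth if it turns smooth maps
into plots. -/
def SmoothFrom {E Z : Type*} [NormedAddCommGroup E] [NormedSpace ℝ E] [DiffeologicalSpace Z]
    (F : E → Z) : Prop :=
  ∀ (m : ℕ) (q : EuclideanSpace ℝ (Fin m) → E), ContDiff ℝ ∞ q → IsPlot (F ∘ q)

section SmoothFrom

variable {E E' Z W : Type*} [NormedAddCommGroup E] [NormedSpace ℝ E] [NormedAddCommGroup E']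
  [NormedSpace ℝ E'] [DiffeologicalSpace Z] [DiffeologicalSpace W]

theorem SmoothFrom.comp_contDiff {F : E → Z} (hF : SmoothFrom F) {r : E' → E}
    (hr : ContDiff ℝ ∞ r) : SmoothFrom fun x => F (r x) :=
  fun m q hq => hF m (r ∘ q) (hr.comp hq)

theorem SmoothFrom.dSmooth_comp {F : E → Z} (hF : SmoothFrom F) {φ : Z → W} (hφ : DSmooth φ) :
    SmoothFrom fun x => φ (F x) :=
  fun m q hq => hφ m _ (hF m q hq)

theorem smoothFrom_const (z : Z) : SmoothFrom fun _ : E => z := fun _ _ _ => isPlot_const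

theorem smoothFrom_of_eventuallyEq {F : E → Z}
    (h : ∀ x, ∃ G : E → Z, SmoothFrom G ∧ F =ᶠ[𝓝 x] G) : SmoothFrom F := by
  intro m q hq
  refine isPlot_of_eventuallyEq fun x => ?_
  obtain ⟨G, hG, hFG⟩ := h (q x)
  exact ⟨G ∘ q, hG m q hq, hq.continuous.continuousAt.eventually hFG⟩

end SmoothFrom

/-! ### Collars of the unit interval -/

/-- Moves the points in the `ε`-collars of the unit interval, and those outside the interval, to
the nearest end. -/
noncomputable def snap (ε x : ℝ) : ℝ := if x ≤ ε then 0 else if 1 - ε ≤ x then 1 else x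

theorem snap_of_le {ε x : ℝ} (h : x ≤ ε) : snap ε x = 0 := if_pos h

theorem snap_of_ge {ε x : ℝ} (hε : ε < 1 / 2) (h : 1 - ε ≤ x) : snap ε x = 1 := by
  rw [snap, if_neg (by linarith), if_pos h]

theorem snap_of_mem {ε x : ℝ} (h₀ : ε < x) (h₁ : x < 1 - ε) : snap ε x = x := by
  rw [snap, if_neg (by linarith), if_neg (by linarith)]

theorem snap_cases {ε : ℝ} (hε : ε < 1 / 2) (x : ℝ) :
    (x ≤ ε ∧ snap ε x = 0) ∨ (1 - ε ≤ x ∧ snap ε x = 1) ∨ (ε < x ∧ x < 1 - ε ∧ snap ε x = x) := by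
  rcases le_or_gt x ε with h | h
  · exact .inl ⟨h, snap_of_le h⟩
  rcases le_or_gt (1 - ε) x with h' | h'
  · exact .inr (.inl ⟨h', snap_of_ge hε h'⟩)
  · exact .inr (.inr ⟨h, h', snap_of_mem h h'⟩)

theorem snap_zero {ε : ℝ} (h₀ : 0 < ε) : snap ε 0 = 0 := snap_of_le h₀.le

theorem snap_one {ε : ℝ} (h₀ : 0 < ε) (hε : ε < 1 / 2) : snap ε 1 = 1 :=
  snap_of_ge hε (by linarith)

theorem snap_one_sub {ε : ℝ} (hε : ε < 1 / 2) (x : ℝ) : snap ε (1 - x) = 1 - snap ε x := by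
  rcases snap_cases hε x with ⟨h, e⟩ | ⟨h, e⟩ | ⟨h, h', e⟩ <;> rw [e]
  · rw [snap_of_ge hε (by linarith)]; ring
  · rw [snap_of_le (by linarith)]; ring
  · rw [snap_of_mem (by linarith) (by linarith)]

theorem snap_snap {δ ε : ℝ} (hδ : 0 < δ) (h : δ ≤ ε) (hε : ε < 1 / 2) (x : ℝ) :
    snap ε (snap δ x) = snap ε x := by
  rcases snap_cases (h.trans_lt hε) x with ⟨h', e⟩ | ⟨h', e⟩ | ⟨_, _, e⟩ <;> rw [e]
  · rw [snap_zero (hδ.trans_le h), snap_of_le (h'.trans h)]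
  · rw [snap_one (hδ.trans_le h) hε, snap_of_ge hε (by linarith)]

/-- A smooth function that rises from `0` to `1` on the interval `[ε / 2, ε]`. -/
noncomputable def rise (ε x : ℝ) : ℝ := Real.smoothTransition ((x - ε / 2) / (ε / 2))

theorem contDiff_rise (ε : ℝ) : ContDiff ℝ ∞ (rise ε) :=
  Real.smoothTransition.contDiff.comp ((contDiff_id.sub contDiff_const).div_const _)

theorem rise_nonneg (ε x : ℝ) : 0 ≤ rise ε x := Real.smoothTransition.nonneg _

theorem rise_le_one (ε x : ℝ) : rise ε x ≤ 1 := Real.smoothTransition.le_one _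

theorem rise_of_le {ε x : ℝ} (hε : 0 < ε) (h : x ≤ ε / 2) : rise ε x = 0 :=
  Real.smoothTransition.zero_of_nonpos (div_nonpos_of_nonpos_of_nonneg (by linarith) (by linarith))

theorem rise_of_ge {ε x : ℝ} (hε : 0 < ε) (h : ε ≤ x) : rise ε x = 1 :=
  Real.smoothTransition.one_of_one_le ((one_le_div (by linarith)).2 (by linarith))

/-- A smooth function that is the identity on `[ε, 1 - ε]` and sends the points at distance at most
`ε / 2` from an end of the unit interval to that end. -/
noncomputable def flat (ε x : ℝ) : ℝ := 1 - rise ε (1 - x) * (1 - rise ε x * x)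

theorem contDiff_flat (ε : ℝ) : ContDiff ℝ ∞ (flat ε) :=
  contDiff_const.sub (((contDiff_rise ε).comp (contDiff_const.sub contDiff_id)).mul
    (contDiff_const.sub ((contDiff_rise ε).mul contDiff_id)))

theorem flat_of_le {ε x : ℝ} (hε : 0 < ε) (hε' : ε < 1 / 2) (h : x ≤ ε / 2) : flat ε x = 0 := by
  rw [flat, rise_of_le hε h, rise_of_ge hε (by linarith)]; ring

theorem flat_of_ge {ε x : ℝ} (hε : 0 < ε) (h : 1 - ε / 2 ≤ x) : flat ε x = 1 := by
  rw [flat, rise_of_le hε (by linarith : 1 - x ≤ ε / 2)]; ring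

theorem flat_of_mem {ε x : ℝ} (hε : 0 < ε) (h : ε ≤ x) (h' : x ≤ 1 - ε) : flat ε x = x := by
  rw [flat, rise_of_ge hε h, rise_of_ge hε (by linarith)]; ring

theorem flat_zero {ε : ℝ} (hε : 0 < ε) (hε' : ε < 1 / 2) : flat ε 0 = 0 :=
  flat_of_le hε hε' (by linarith)

theorem flat_one {ε : ℝ} (hε : 0 < ε) : flat ε 1 = 1 := flat_of_ge hε (by linarith)

theorem flat_mem_of_le {ε x : ℝ} (hε : 0 < ε) (hε' : ε < 1 / 2) (h : x ≤ ε) :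
    0 ≤ flat ε x ∧ flat ε x ≤ ε := by
  rcases le_or_gt x (ε / 2) with h' | h'
  · rw [flat_of_le hε hε' h']; exact ⟨le_rfl, hε.le⟩
  · have e : flat ε x = rise ε x * x := by
      rw [flat, rise_of_ge hε (by linarith : ε ≤ 1 - x)]; ring
    have h₀ := rise_nonneg ε x
    have h₁ := rise_le_one ε x
    rw [e]
    constructor <;> nlinarith

theorem flat_mem_of_ge {ε x : ℝ} (hε : 0 < ε) (hε' : ε < 1 / 2) (h : 1 - ε ≤ x) :
    1 - ε ≤ flat ε x ∧ flat ε x ≤ 1 := by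
  rcases le_or_gt (1 - ε / 2) x with h' | h'
  · rw [flat_of_ge hε h']; exact ⟨by linarith, le_rfl⟩
  · have e : flat ε x = 1 - rise ε (1 - x) * (1 - x) := by
      rw [flat, rise_of_ge hε (by linarith : ε ≤ x)]; ring
    have h₀ := rise_nonneg ε (1 - x)
    have h₁ := rise_le_one ε (1 - x)
    rw [e]
    constructor <;> nlinarith

theorem flat_mem {ε : ℝ} (hε : 0 < ε) (hε' : ε < 1 / 2) (x : ℝ) :
    0 ≤ flat ε x ∧ flat ε x ≤ 1 := by
  rcases snap_cases hε' x with ⟨h, -⟩ | ⟨h, -⟩ | ⟨h, h', -⟩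
  · have := flat_mem_of_le hε hε' h; constructor <;> linarith
  · have := flat_mem_of_ge hε hε' h; constructor <;> linarith
  · rw [flat_of_mem hε h.le h'.le]; constructor <;> linarith

theorem flat_snap {ε : ℝ} (hε : 0 < ε) (hε' : ε < 1 / 2) (x : ℝ) :
    flat ε (snap (ε / 2) x) = flat ε x := by
  rcases snap_cases (by linarith : ε / 2 < 1 / 2) x with ⟨h, e⟩ | ⟨h, e⟩ | ⟨h, h', e⟩ <;> rw [e]
  · rw [flat_of_le hε hε' h, flat_zero hε hε']
  · rw [flat_of_ge hε h, flat_one hε]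

/-- Points on the segment from `x` to `flat ε x` have the same image under `snap ε` as `x`. -/
theorem snap_segment {ε : ℝ} (hε : 0 < ε) (hε' : ε < 1 / 2) (x : ℝ) {σ : ℝ} (h₀ : 0 ≤ σ)
    (h₁ : σ ≤ 1) : snap ε ((1 - σ) * x + σ * flat ε x) = snap ε x := by
  rcases snap_cases hε' x with ⟨h, e⟩ | ⟨h, e⟩ | ⟨h, h', e⟩
  · have := flat_mem_of_le hε hε' h
    rw [e, snap_of_le (by nlinarith)]
  · have := flat_mem_of_ge hε hε' h
    rw [e, snap_of_ge hε' (by nlinarith)]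
  · rw [flat_of_mem hε h.le h'.le]; congr 1; ring

theorem snap_flat {ε : ℝ} (hε : 0 < ε) (hε' : ε < 1 / 2) (x : ℝ) :
    snap ε (flat ε x) = snap ε x := by
  simpa using snap_segment hε hε' x zero_le_one le_rfl

/-! ### Tame cubes and tame boundary data, as maps on the whole of `ℝⁿ` -/

/-- The point with first coordinate `s` and remaining coordinates `t`. -/
abbrev pt {n : ℕ} (s : ℝ) (t : Fin n → ℝ) : Fin (n + 1) → ℝ := Fin.cons s t

theorem contDiff_pt {E : Type*} [NormedAddCommGroup E] [NormedSpace ℝ E] {n : ℕ} {f : E → ℝ}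
    {g : E → Fin n → ℝ} (hf : ContDiff ℝ ∞ f) (hg : ContDiff ℝ ∞ g) :
    ContDiff ℝ ∞ fun x => pt (f x) (g x) := by
  refine contDiff_pi.2 fun i => ?_
  refine Fin.cases ?_ (fun j => ?_) i
  · simpa using hf
  · simpa using contDiff_pi.1 hg j

theorem contDiff_tail {n : ℕ} : ContDiff ℝ ∞ (Fin.tail : (Fin (n + 1) → ℝ) → Fin n → ℝ) :=
  contDiff_pi.2 fun j => contDiff_apply ℝ ℝ j.succ

theorem contDiff_update {n : ℕ} (j : Fin n) (α : ℝ) :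
    ContDiff ℝ ∞ fun t : Fin n → ℝ => Function.update t j α := by
  refine contDiff_pi.2 fun i => ?_
  by_cases h : i = j
  · subst h; simpa using contDiff_const
  · simpa [Function.update_of_ne h] using contDiff_apply ℝ ℝ i

theorem contDiff_flat_comp (ε : ℝ) {n : ℕ} : ContDiff ℝ ∞ fun t : Fin n → ℝ => flat ε ∘ t :=
  contDiff_pi.2 fun i => (contDiff_flat ε).comp (contDiff_apply ℝ ℝ i)

theorem comp_pt {n : ℕ} (f : ℝ → ℝ) (s : ℝ) (t : Fin n → ℝ) : f ∘ pt s t = pt (f s) (f ∘ t) :=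
  Fin.comp_cons f s t

theorem exists_eq_pt {n : ℕ} (x : Fin (n + 1) → ℝ) : ∃ s t, x = pt s t :=
  ⟨x 0, Fin.tail x, (Fin.cons_self_tail x).symm⟩

theorem update_pt_zero {n : ℕ} (s α : ℝ) (t : Fin n → ℝ) :
    Function.update (pt s t) 0 α = pt α t := Fin.update_cons_zero _ _ _

theorem update_pt_succ {n : ℕ} (s α : ℝ) (t : Fin n → ℝ) (j : Fin n) :
    Function.update (pt s t) j.succ α = pt s (Function.update t j α) :=
  (Fin.cons_update _ _ _ _).symm

/-- The union of the hyperplanes spanned by the faces of the cube. -/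
def faces (n : ℕ) : Set (Fin n → ℝ) := {t | ∃ j, t j = 0 ∨ t j = 1}

theorem update_mem_faces {n : ℕ} (t : Fin n → ℝ) (j : Fin n) {α : ℝ} (hα : α = 0 ∨ α = 1) :
    Function.update t j α ∈ faces n := ⟨j, by simpa using hα⟩

theorem pt_mem_faces {n : ℕ} (s : ℝ) {t : Fin n → ℝ} (ht : t ∈ faces n) :
    pt s t ∈ faces (n + 1) := by
  obtain ⟨j, hj⟩ := ht
  exact ⟨j.succ, by simpa using hj⟩

theorem pt_zero_mem_faces {n : ℕ} (t : Fin n → ℝ) : pt 0 t ∈ faces (n + 1) := ⟨0, by simp⟩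

theorem pt_one_mem_faces {n : ℕ} (t : Fin n → ℝ) : pt 1 t ∈ faces (n + 1) := ⟨0, by simp⟩

theorem pt_mem_faces_iff {n : ℕ} {s : ℝ} {t : Fin n → ℝ} :
    pt s t ∈ faces (n + 1) ↔ s = 0 ∨ s = 1 ∨ t ∈ faces n := by
  simp [faces, Fin.exists_fin_succ, or_assoc]

theorem snap_mem_faces {ε : ℝ} (h₀ : 0 < ε) (hε : ε < 1 / 2) {n : ℕ} {t : Fin n → ℝ}
    (ht : t ∈ faces n) : snap ε ∘ t ∈ faces n := by
  obtain ⟨j, hj | hj⟩ := ht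
  · exact ⟨j, .inl (by simp [hj, snap_zero h₀])⟩
  · exact ⟨j, .inr (by simp [hj, snap_one h₀ hε])⟩

theorem flat_mem_faces {ε : ℝ} (h₀ : 0 < ε) (hε : ε < 1 / 2) {n : ℕ} {t : Fin n → ℝ}
    (ht : t ∈ faces n) : flat ε ∘ t ∈ faces n := by
  obtain ⟨j, hj | hj⟩ := ht
  · exact ⟨j, .inl (by simp [hj, flat_zero h₀ hε])⟩
  · exact ⟨j, .inr (by simp [hj, flat_one h₀])⟩

theorem snap_comp_snap {δ ε : ℝ} (hδ : 0 < δ) (h : δ ≤ ε) (hε : ε < 1 / 2) {n : ℕ}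
    (t : Fin n → ℝ) : snap ε ∘ snap δ ∘ t = snap ε ∘ t :=
  funext fun j => snap_snap hδ h hε (t j)

theorem snap_comp_flat {ε : ℝ} (h₀ : 0 < ε) (hε : ε < 1 / 2) {n : ℕ} (t : Fin n → ℝ) :
    snap ε ∘ flat ε ∘ t = snap ε ∘ t :=
  funext fun j => snap_flat h₀ hε (t j)

theorem flat_comp_snap {ε : ℝ} (h₀ : 0 < ε) (hε : ε < 1 / 2) {n : ℕ} (t : Fin n → ℝ) :
    flat ε ∘ snap (ε / 2) ∘ t = flat ε ∘ t :=
  funext fun j => flat_snap h₀ hε (t j)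

section Tame

variable {Z W : Type*} [DiffeologicalSpace Z] [DiffeologicalSpace W] {n : ℕ} {δ ε : ℝ}

/-- An `ε`-tame cube, extended to `ℝⁿ`. -/
structure IsTameCube (ε : ℝ) (F : (Fin n → ℝ) → Z) : Prop where
  smooth : SmoothFrom F
  tame : ∀ t, F (snap ε ∘ t) = F t

/-- `ε`-tame data on the boundary of the cube, extended to `faces n`. The values elsewhere are
irrelevant. -/
structure IsTameBoundary (ε : ℝ) (h : (Fin n → ℝ) → Z) : Prop where
  smooth : ∀ (j : Fin n) (α : ℝ), (α = 0 ∨ α = 1) → SmoothFrom fun t => h (Function.update t j α)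
  tame : ∀ t ∈ faces n, h (snap ε ∘ t) = h t

/-- `ε`-tame data on the product of an interval and the boundary of the cube. The values
elsewhere are irrelevant. -/
structure IsTameSides (ε : ℝ) (S : (Fin (n + 1) → ℝ) → Z) : Prop where
  smooth : ∀ (j : Fin n) (α : ℝ), (α = 0 ∨ α = 1) →
    SmoothFrom fun x => S (Function.update x j.succ α)
  tame : ∀ s, ∀ t ∈ faces n, S (pt (snap ε s) (snap ε ∘ t)) = S (pt s t)

/-- A tame cube, extended to `ℝⁿ`. -/
def TameCube (F : (Fin n → ℝ) → Z) : Prop := ∃ ε, 0 < ε ∧ ε < 1 / 2 ∧ IsTameCube ε F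

theorem IsTameCube.mono {F : (Fin n → ℝ) → Z} (hF : IsTameCube ε F) (hδ : 0 < δ) (h : δ ≤ ε)
    (hε : ε < 1 / 2) : IsTameCube δ F where
  smooth := hF.smooth
  tame t := by rw [← hF.tame (snap δ ∘ t), snap_comp_snap hδ h hε, hF.tame]

theorem IsTameSides.mono {S : (Fin (n + 1) → ℝ) → Z} (hS : IsTameSides ε S) (hδ : 0 < δ)
    (h : δ ≤ ε) (hε : ε < 1 / 2) : IsTameSides δ S where
  smooth := hS.smooth
  tame s t ht := by
    rw [← hS.tame _ _ (snap_mem_faces hδ (h.trans_lt hε) ht), snap_comp_snap hδ h hε,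
      snap_snap hδ h hε, hS.tame _ _ ht]

theorem IsTameCube.isTameSides {S : (Fin (n + 1) → ℝ) → Z} (hS : IsTameCube ε S) :
    IsTameSides ε S where
  smooth _ _ _ := hS.smooth.comp_contDiff (contDiff_update _ _)
  tame s t _ := by rw [← comp_pt, hS.tame]

theorem IsTameBoundary.isTameSides {h : (Fin (n + 1) → ℝ) → Z} (hh : IsTameBoundary ε h) :
    IsTameSides ε h where
  smooth j α hα := hh.smooth j.succ α hα
  tame s t ht := by rw [← comp_pt, hh.tame _ (pt_mem_faces s ht)]

theorem IsTameBoundary.isTameCube_face {h : (Fin (n + 1) → ℝ) → Z} (hh : IsTameBoundary ε h)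
    (h₀ : 0 < ε) (hε : ε < 1 / 2) {α : ℝ} (hα : α = 0 ∨ α = 1) :
    IsTameCube ε fun t => h (pt α t) where
  smooth := by
    have := (hh.smooth 0 α hα).comp_contDiff (contDiff_pt (contDiff_const (c := 0)) contDiff_id)
    simpa only [update_pt_zero, id] using this
  tame t := by
    have hm : pt α t ∈ faces (n + 1) := pt_mem_faces_iff.2 (by tauto)
    have : snap ε α = α := by
      rcases hα with rfl | rfl
      exacts [snap_zero h₀, snap_one h₀ hε]
    rw [← hh.tame _ hm, comp_pt, this]

theorem IsTameCube.apply_flat {F : (Fin n → ℝ) → Z} (hF : IsTameCube ε F) (h₀ : 0 < ε)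
    (hε : ε < 1 / 2) (t : Fin n → ℝ) : F (flat ε ∘ t) = F t := by
  rw [← hF.tame, snap_comp_flat h₀ hε, hF.tame]

/-- `flat ε` is constant on the `ε / 2`-collars, so it forgets exactly what tameness requires to be
forgotten. With `IsTameCube.apply_flat` this allows constructions to lose tameness and regain it
without disturbing their tame faces. -/
theorem SmoothFrom.isTameCube_flat {F : (Fin n → ℝ) → Z} (hF : SmoothFrom F) (h₀ : 0 < ε)
    (hε : ε < 1 / 2) : IsTameCube (ε / 2) fun t => F (flat ε ∘ t) where
  smooth := hF.comp_contDiff (contDiff_flat_comp ε)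
  tame t := by rw [flat_comp_snap h₀ hε]

theorem IsTameCube.dSmooth_comp {F : (Fin n → ℝ) → Z} (hF : IsTameCube ε F) {φ : Z → W}
    (hφ : DSmooth φ) : IsTameCube ε fun t => φ (F t) where
  smooth := hF.smooth.dSmooth_comp hφ
  tame t := by rw [hF.tame]

theorem TameCube.dSmooth_comp {F : (Fin n → ℝ) → Z} (hF : TameCube F) {φ : Z → W}
    (hφ : DSmooth φ) : TameCube fun t => φ (F t) := by
  obtain ⟨ε, h₀, h₁, h⟩ := hF
  exact ⟨ε, h₀, h₁, h.dSmooth_comp hφ⟩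

theorem tameCube_const (z : Z) : TameCube fun _ : Fin n → ℝ => z :=
  ⟨1 / 4, by norm_num, by norm_num, smoothFrom_const z, fun _ => rfl⟩

theorem IsTameCube.face {F : (Fin (n + 1) → ℝ) → Z} (hF : IsTameCube ε F) (h₀ : 0 < ε)
    (hε : ε < 1 / 2) {α : ℝ} (hα : α = 0 ∨ α = 1) : IsTameCube ε fun t => F (pt α t) where
  smooth := hF.smooth.comp_contDiff (contDiff_pt contDiff_const contDiff_id)
  tame t := by
    have : snap ε α = α := by
      rcases hα with rfl | rfl
      exacts [snap_zero h₀, snap_one h₀ hε]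
    rw [← hF.tame (pt α t), comp_pt, this]

theorem TameCube.face {F : (Fin (n + 1) → ℝ) → Z} (hF : TameCube F) {α : ℝ}
    (hα : α = 0 ∨ α = 1) : TameCube fun t => F (pt α t) := by
  obtain ⟨ε, h₀, h₁, h⟩ := hF
  exact ⟨ε, h₀, h₁, h.face h₀ h₁ hα⟩

theorem IsTameCube.degenerate {F : (Fin n → ℝ) → Z} (hF : IsTameCube ε F) :
    IsTameCube ε fun x : Fin (n + 1) → ℝ => F (Fin.tail x) where
  smooth := hF.smooth.comp_contDiff contDiff_tail
  tame x := hF.tame (Fin.tail x)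

theorem TameCube.degenerate {F : (Fin n → ℝ) → Z} (hF : TameCube F) :
    TameCube fun x : Fin (n + 1) → ℝ => F (Fin.tail x) := by
  obtain ⟨ε, h₀, h₁, h⟩ := hF
  exact ⟨ε, h₀, h₁, h.degenerate⟩

theorem TameCube.degenerate_second {F : (Fin (n + 1) → ℝ) → Z} (hF : TameCube F) :
    TameCube fun x : Fin (n + 2) → ℝ => F (pt (x 0) (Fin.tail (Fin.tail x))) := by
  obtain ⟨ε, h₀, h₁, h⟩ := hF
  refine ⟨ε, h₀, h₁, h.smooth.comp_contDiff
    (contDiff_pt (contDiff_apply ℝ ℝ 0) (contDiff_tail.comp contDiff_tail)), fun x => ?_⟩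
  rw [← h.tame (pt (x 0) _), comp_pt]
  rfl

theorem TameCube.reflect {F : (Fin (n + 1) → ℝ) → Z} (hF : TameCube F) :
    TameCube fun x : Fin (n + 1) → ℝ => F (pt (1 - x 0) (Fin.tail x)) := by
  obtain ⟨ε, h₀, h₁, h⟩ := hF
  refine ⟨ε, h₀, h₁, h.smooth.comp_contDiff
    (contDiff_pt (contDiff_const.sub (contDiff_apply ℝ ℝ 0)) contDiff_tail), fun x => ?_⟩
  rw [← h.tame (pt (1 - x 0) _), comp_pt, snap_one_sub h₁]
  rfl

/-! ### Filling open boxes -/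

/-- A smooth function that is `1` on `faces n` and vanishes at the points of the cube at distance
at least `ε` from them. -/
noncomputable def nearFaces (ε : ℝ) (t : Fin n → ℝ) : ℝ :=
  1 - ∏ j, rise ε (t j) * rise ε (1 - t j)

theorem contDiff_nearFaces (ε : ℝ) : ContDiff ℝ ∞ (nearFaces ε : (Fin n → ℝ) → ℝ) :=
  contDiff_const.sub (contDiff_prod fun j _ =>
    ((contDiff_rise ε).comp (contDiff_apply ℝ ℝ j)).mul
      ((contDiff_rise ε).comp (contDiff_const.sub (contDiff_apply ℝ ℝ j))))

theorem nearFaces_of_mem (h₀ : 0 < ε) {t : Fin n → ℝ} (ht : t ∈ faces n) :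
    nearFaces ε t = 1 := by
  obtain ⟨j, hj⟩ := ht
  rw [nearFaces, Finset.prod_eq_zero (Finset.mem_univ j), sub_zero]
  rcases hj with hj | hj
  · rw [hj, rise_of_le h₀ (by linarith), zero_mul]
  · rw [hj, sub_self, rise_of_le h₀ (by linarith : (0 : ℝ) ≤ ε / 2), mul_zero]

theorem nearFaces_of_forall (h₀ : 0 < ε) {t : Fin n → ℝ} (ht : ∀ j, ε ≤ t j ∧ t j ≤ 1 - ε) :
    nearFaces ε t = 0 := by
  rw [nearFaces, Finset.prod_eq_one, sub_self]
  intro j _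
  rw [rise_of_ge h₀ (ht j).1, rise_of_ge h₀ (by linarith [(ht j).2]), one_mul]

/-- In the collar of the sides the value is read off the nearest side, at a height scaled by a
cutoff that falls from `1` on the faces to `0` inside the collar. At height `0` the side agrees with
the bottom, so the result joins smoothly to `b`. The cutoff varies within the collar, so tameness is
lost here and restored in `exists_fill`. -/
theorem exists_fill_aux {S : (Fin (n + 1) → ℝ) → Z} {b : (Fin n → ℝ) → Z} (h₀ : 0 < ε)
    (hε : ε < 1 / 2) (hS : IsTameSides ε S) (hb : IsTameCube ε b)
    (hSb : ∀ t ∈ faces n, S (pt 0 t) = b t) :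
    ∃ K : (Fin (n + 1) → ℝ) → Z, SmoothFrom K ∧ (∀ t, K (pt 0 t) = b t) ∧
      ∀ t ∈ faces n, ∀ s, K (pt s t) = S (pt s t) := by
  classical
  have key : ∀ s t, snap ε ∘ t ∈ faces n → ∀ t', snap ε ∘ t' = snap ε ∘ t → t' ∈ faces n →
      S (pt s (snap ε ∘ t)) = S (pt s t') := by
    intro s t ht t' h h'
    rw [← hS.tame s t' h', ← hS.tame s _ ht, h, snap_comp_snap h₀ le_rfl hε]
  refine ⟨fun x => if snap ε ∘ Fin.tail x ∈ faces n then
    S (pt (nearFaces (ε / 2) (Fin.tail x) * x 0) (snap ε ∘ Fin.tail x)) else b (Fin.tail x),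
    smoothFrom_of_eventuallyEq fun x => ?_, fun t => ?_, fun t ht s => ?_⟩
  -- Either some coordinate snaps to a fixed end throughout a neighbourhood, where the filler is a
  -- smooth formula on that face, or every coordinate lies in `[ε, 1 - ε]`.
  · by_cases hx : ∃ (j : Fin n) (α : ℝ), (α = 0 ∨ α = 1) ∧ ∀ᶠ y in 𝓝 x, snap ε (y j.succ) = α
    · obtain ⟨j, α, hα, hj⟩ := hx
      refine ⟨fun y => S (Function.update
        (pt (nearFaces (ε / 2) (Fin.tail y) * y 0) (Fin.tail y)) j.succ α),
        (hS.smooth j α hα).comp_contDiff (contDiff_pt (((contDiff_nearFaces _).comp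
          contDiff_tail).mul (contDiff_apply ℝ ℝ 0)) contDiff_tail), ?_⟩
      filter_upwards [hj] with y hy
      have hm : snap ε ∘ Fin.tail y ∈ faces n := ⟨j, by
        show snap ε (y j.succ) = 0 ∨ snap ε (y j.succ) = 1
        rwa [hy]⟩
      rw [if_pos hm, update_pt_succ]
      refine key _ _ hm _ (funext fun i => ?_) (update_mem_faces _ _ hα)
      by_cases hi : i = j
      · subst hi
        have : snap ε (Fin.tail y i) = α := hy
        rw [Function.comp_apply, Function.comp_apply, Function.update_self, this]
        rcases hα with rfl | rfl
        exacts [snap_zero h₀, snap_one h₀ hε]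
      · simp [Function.update_of_ne hi]
    · have hmem : ∀ j : Fin n, ε ≤ x j.succ ∧ x j.succ ≤ 1 - ε := by
        intro j
        by_contra hj
        rw [not_and_or, not_le, not_le] at hj
        refine hx ⟨j, ?_⟩
        have hc : ContinuousAt (fun y : Fin (n + 1) → ℝ => y j.succ) x :=
          (continuous_apply _).continuousAt
        rcases hj with hj | hj
        · exact ⟨0, .inl rfl, (hc.eventually_lt_const hj).mono fun y hy => snap_of_le hy.le⟩
        · exact ⟨1, .inr rfl, (hc.eventually_const_lt hj).mono fun y hy => snap_of_ge hε hy.le⟩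
      -- Nearby coordinates stay in `(ε / 2, 1 - ε / 2)`, where the cutoff vanishes, so both
      -- branches equal `b`.
      refine ⟨fun y => b (Fin.tail y), hb.smooth.comp_contDiff contDiff_tail, ?_⟩
      have hn : ∀ᶠ y in 𝓝 x, ∀ j : Fin n, ε / 2 < y j.succ ∧ y j.succ < 1 - ε / 2 := by
        refine Filter.eventually_all.2 fun j => ?_
        have hc : ContinuousAt (fun y : Fin (n + 1) → ℝ => y j.succ) x :=
          (continuous_apply _).continuousAt
        exact (hc.eventually_const_lt (by linarith [(hmem j).1])).and
          (hc.eventually_lt_const (by linarith [(hmem j).2]))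
      filter_upwards [hn] with y hy
      split_ifs with hm
      · have hz : nearFaces (ε / 2) (Fin.tail y) = 0 :=
          nearFaces_of_forall (by linarith) fun j => ⟨(hy j).1.le, (hy j).2.le⟩
        rw [hz, zero_mul, hSb _ hm, hb.tame]
      · rfl
  · simp only [Fin.cons_zero, Fin.tail_cons, mul_zero]
    split_ifs with hm
    · rw [hSb _ hm, hb.tame]
    · rfl
  · simp only [Fin.cons_zero, Fin.tail_cons]
    rw [if_pos (snap_mem_faces h₀ hε ht), nearFaces_of_mem (by linarith) ht, one_mul]
    exact key s t (snap_mem_faces h₀ hε ht) t rfl ht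

/-- Tame open boxes can be filled. -/
theorem exists_fill {S : (Fin (n + 1) → ℝ) → Z} {b : (Fin n → ℝ) → Z} (h₀ : 0 < ε)
    (hε : ε < 1 / 2) (hS : IsTameSides ε S) (hb : TameCube b)
    (hSb : ∀ t ∈ faces n, S (pt 0 t) = b t) :
    ∃ K : (Fin (n + 1) → ℝ) → Z, TameCube K ∧ (∀ t, K (pt 0 t) = b t) ∧
      ∀ t ∈ faces n, ∀ s, K (pt s t) = S (pt s t) := by
  obtain ⟨δ, hδ₀, hδ₁, hb⟩ := hb
  have hm : 0 < min δ ε := lt_min hδ₀ h₀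
  have hm' : min δ ε < 1 / 2 := (min_le_left _ _).trans_lt hδ₁
  have hS' := hS.mono hm (min_le_right _ _) hε
  have hb' := hb.mono hm (min_le_left _ _) hδ₁
  obtain ⟨K, hK, hK₀, hKS⟩ := exists_fill_aux hm hm' hS' hb' hSb
  -- Flattening restores tameness; the bottom and the sides, being tame already, are unchanged.
  refine ⟨fun x => K (flat (min δ ε) ∘ x), ⟨_, by linarith, by linarith,
    hK.isTameCube_flat hm hm'⟩, fun t => ?_, fun t ht s => ?_⟩
  · dsimp only
    rw [comp_pt, flat_zero hm hm', hK₀, hb'.apply_flat hm hm']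
  · dsimp only
    rw [comp_pt, hKS _ (flat_mem_faces hm hm' ht),
      ← hS'.tame _ _ (flat_mem_faces hm hm' ht), snap_comp_flat hm hm', snap_flat hm hm',
      hS'.tame _ _ ht]

/-- The top face of a filler of the open box with bottom `b` whose side `x₁ = 1` is given by `V`
and whose other sides are given by `U`. -/
theorem exists_fill_two {U : (Fin (n + 2) → ℝ) → Z} {V b : (Fin (n + 1) → ℝ) → Z}
    (hU : TameCube U) (hV : TameCube V) (hb : TameCube b)
    (hUV : ∀ t ∈ faces n, ∀ s, U (pt s (pt 1 t)) = V (pt s t))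
    (hbU₀ : ∀ t, b (pt 0 t) = U (pt 0 (pt 0 t))) (hbV : ∀ t, b (pt 1 t) = V (pt 0 t))
    (hbU : ∀ t ∈ faces n, ∀ r, b (pt r t) = U (pt 0 (pt r t))) :
    ∃ L : (Fin (n + 1) → ℝ) → Z, TameCube L ∧ (∀ t, L (pt 0 t) = U (pt 1 (pt 0 t))) ∧
      (∀ t, L (pt 1 t) = V (pt 1 t)) ∧ ∀ t ∈ faces n, ∀ r, L (pt r t) = U (pt 1 (pt r t)) := by
  classical
  obtain ⟨δ, hδ₀, hδ₁, hU⟩ := hU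
  obtain ⟨ε, hε₀, hε₁, hV⟩ := hV
  have hm : 0 < min δ ε := lt_min hδ₀ hε₀
  have hm' : min δ ε < 1 / 2 := (min_le_left _ _).trans_lt hδ₁
  replace hU := hU.mono hm (min_le_left _ _) hδ₁
  replace hV := hV.mono hm (min_le_right _ _) hε₁
  set ε' := min δ ε
  -- Coordinate `0` is the height of the box and coordinate `1` the direction of the homotopy on its
  -- bottom and top. Smoothness is only asked face by face, so the jump at `x 1 = 1` is harmless: on
  -- the remaining faces `hUV` makes the two formulas agree.
  set S : (Fin (n + 2) → ℝ) → Z := fun x =>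
    if x 1 = 1 then V (pt (x 0) (Fin.tail (Fin.tail x))) else U x with hSdef
  have hS₁ : ∀ s t, S (pt s (pt 1 t)) = V (pt s t) := fun s t => by
    have : (pt s (pt 1 t) : Fin (n + 2) → ℝ) 1 = 1 := rfl
    simp [hSdef, this, Fin.tail_cons]
  have hS₂ : ∀ s r t, (r ≠ 1 ∨ t ∈ faces n) → S (pt s (pt r t)) = U (pt s (pt r t)) := by
    intro s r t h
    by_cases hr : r = 1
    · subst hr; rw [hS₁, hUV _ (h.resolve_left (by simp))]
    · have : (pt s (pt r t) : Fin (n + 2) → ℝ) 1 = r := rfl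
      simp only [hSdef, this, if_neg hr]
  have hS : IsTameSides ε' S := by
    refine ⟨fun j α hα => ?_, fun s x hx => ?_⟩
    · refine Fin.cases ?_ (fun i => ?_) j
      · rcases hα with rfl | rfl
        · have : (fun x => S (Function.update x (Fin.succ 0) 0)) =
              fun x => U (Function.update x (Fin.succ 0) 0) := by
            funext x
            obtain ⟨s, y, rfl⟩ := exists_eq_pt x
            obtain ⟨r, t, rfl⟩ := exists_eq_pt y
            rw [update_pt_succ, update_pt_zero, hS₂ _ _ _ (.inl zero_ne_one)]
          rw [this]
          exact hU.smooth.comp_contDiff (contDiff_update _ _)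
        · have : (fun x => S (Function.update x (Fin.succ 0) 1)) =
              fun x => V (pt (x 0) (Fin.tail (Fin.tail x))) := by
            funext x
            obtain ⟨s, y, rfl⟩ := exists_eq_pt x
            obtain ⟨r, t, rfl⟩ := exists_eq_pt y
            rw [update_pt_succ, update_pt_zero, hS₁]
            rfl
          rw [this]
          exact hV.smooth.comp_contDiff
            (contDiff_pt (contDiff_apply ℝ ℝ 0) (contDiff_tail.comp contDiff_tail))
      · have : (fun x => S (Function.update x i.succ.succ α)) =
            fun x => U (Function.update x i.succ.succ α) := by
          funext x
          obtain ⟨s, y, rfl⟩ := exists_eq_pt x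
          obtain ⟨r, t, rfl⟩ := exists_eq_pt y
          rw [update_pt_succ, update_pt_succ, hS₂ _ _ _ (.inr (update_mem_faces _ _ hα))]
        rw [this]
        exact hU.smooth.comp_contDiff (contDiff_update _ _)
    · obtain ⟨r, t, rfl⟩ := exists_eq_pt x
      rw [comp_pt]
      by_cases hr : r = 1
      · subst hr
        rw [snap_one hm hm', hS₁, hS₁, ← comp_pt, hV.tame]
      · have h : r = 0 ∨ t ∈ faces n := by
          rcases pt_mem_faces_iff.1 hx with h | h | h <;> tauto
        rw [hS₂ s r t (.inl hr), hS₂, ← comp_pt, ← comp_pt, hU.tame]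
        rcases h with rfl | h
        · exact .inl (by rw [snap_zero hm]; exact zero_ne_one)
        · exact .inr (snap_mem_faces hm hm' h)
  obtain ⟨K, hK, -, hKS⟩ := exists_fill hm hm' hS hb (by
    intro x hx
    obtain ⟨r, t, rfl⟩ := exists_eq_pt x
    by_cases hr : r = 1
    · subst hr; rw [hS₁, hbV]
    · rw [hS₂ _ _ _ (.inl hr)]
      rcases pt_mem_faces_iff.1 hx with rfl | h | h
      exacts [(hbU₀ t).symm, absurd h hr, (hbU t h r).symm])
  refine ⟨fun x => K (pt 1 x), hK.face (.inr rfl), fun t => ?_, fun t => ?_, fun t ht r => ?_⟩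
  · dsimp only
    rw [hKS _ (pt_zero_mem_faces t), hS₂ _ _ _ (.inl zero_ne_one)]
  · dsimp only
    rw [hKS _ (pt_one_mem_faces t), hS₁]
  · dsimp only
    rw [hKS _ (pt_mem_faces r ht), hS₂ _ _ _ (.inr ht)]

end Tame

/-! ### Tame homotopies relative to the boundary -/

section TameHomotopic

variable {Z W : Type*} [DiffeologicalSpace Z] [DiffeologicalSpace W] {n : ℕ}

/-- Homotopy of tame cubes relative to the boundary, by a homotopy that is a tame cube. -/
def TameHomotopic (a b : (Fin n → ℝ) → Z) : Prop :=
  ∃ K : (Fin (n + 1) → ℝ) → Z, TameCube K ∧ (∀ t, K (pt 0 t) = a t) ∧ (∀ t, K (pt 1 t) = b t) ∧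
    ∀ t ∈ faces n, ∀ s, K (pt s t) = a t

theorem TameHomotopic.eq_of_mem_faces {a b : (Fin n → ℝ) → Z} (h : TameHomotopic a b)
    {t : Fin n → ℝ} (ht : t ∈ faces n) : a t = b t := by
  obtain ⟨K, -, -, h₁, hK⟩ := h
  rw [← h₁, hK t ht]

theorem TameHomotopic.refl {a : (Fin n → ℝ) → Z} (ha : TameCube a) : TameHomotopic a a :=
  ⟨_, ha.degenerate, fun _ => rfl, fun _ => rfl, fun _ _ _ => rfl⟩

theorem TameHomotopic.symm {a b : (Fin n → ℝ) → Z} (h : TameHomotopic a b) :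
    TameHomotopic b a := by
  have hab := fun t ht => h.eq_of_mem_faces (t := t) ht
  obtain ⟨K, hK, h₀, h₁, hf⟩ := h
  refine ⟨_, hK.reflect, fun t => ?_, fun t => ?_, fun t ht s => ?_⟩ <;>
    simp only [Fin.cons_zero, Fin.tail_cons]
  · rw [sub_zero, h₁]
  · rw [sub_self, h₀]
  · rw [hf t ht, hab t ht]

theorem TameHomotopic.dSmooth_comp {a b : (Fin n → ℝ) → Z} (h : TameHomotopic a b) {φ : Z → W}
    (hφ : DSmooth φ) : TameHomotopic (fun t => φ (a t)) fun t => φ (b t) := by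
  obtain ⟨K, hK, h₀, h₁, hf⟩ := h
  exact ⟨_, hK.dSmooth_comp hφ, fun t => congrArg φ (h₀ t), fun t => congrArg φ (h₁ t),
    fun t ht s => congrArg φ (hf t ht s)⟩

/-- Two homotopies that agree on the sides and start at homotopic cubes end at homotopic cubes. -/
theorem TameHomotopic.transport {C D : (Fin (n + 1) → ℝ) → Z} (hC : TameCube C)
    (hD : TameCube D) (hCD : ∀ t ∈ faces n, ∀ s, C (pt s t) = D (pt s t))
    (h : TameHomotopic (fun t => C (pt 0 t)) fun t => D (pt 0 t)) :
    TameHomotopic (fun t => C (pt 1 t)) fun t => D (pt 1 t) := by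
  obtain ⟨Q, hQ, h₀, h₁, hf⟩ := h
  -- The bottom of the box is the given homotopy `Q`, its two opposite walls are `C` and `D`, and
  -- its other walls are independent of the parameter of `Q`.
  exact exists_fill_two hC.degenerate_second hD hQ hCD h₀ h₁ hf

/-- The top of a tame cube can be replaced by a homotopic one without changing the bottom and the
sides. -/
theorem exists_replace_top {K : (Fin (n + 1) → ℝ) → Z} (hK : TameCube K) {c : (Fin n → ℝ) → Z}
    (h : TameHomotopic (fun t => K (pt 1 t)) c) :
    ∃ L : (Fin (n + 1) → ℝ) → Z, TameCube L ∧ (∀ t, L (pt 0 t) = K (pt 0 t)) ∧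
      (∀ t, L (pt 1 t) = c t) ∧ ∀ t ∈ faces n, ∀ s, L (pt s t) = K (pt s t) := by
  obtain ⟨Q, hQ, h₀, h₁, hf⟩ := h
  -- The bottom of the box is `K` itself; its walls are stationary except the one over the top of
  -- `K`, which runs through `Q`.
  obtain ⟨L, hL, hL₀, hL₁, hLf⟩ := exists_fill_two (U := fun x => K (Fin.tail x))
    hK.degenerate hQ hK (fun t ht s => (hf t ht s).symm) (fun _ => rfl) (fun t => (h₀ t).symm) fun _ _ _ => rfl
  exact ⟨L, hL, hL₀, fun t => (hL₁ t).trans (h₁ t), hLf⟩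

/-- Homotopies need not be concatenated: the end of the first is replaced along the second. -/
theorem TameHomotopic.trans {a b c : (Fin n → ℝ) → Z} (h : TameHomotopic a b)
    (h' : TameHomotopic b c) : TameHomotopic a c := by
  obtain ⟨K, hK, h₀, h₁, hf⟩ := h
  obtain ⟨L, hL, hL₀, hL₁, hLf⟩ := exists_replace_top hK (c := c) (by simpa only [h₁] using h')
  exact ⟨L, hL, fun t => (hL₀ t).trans (h₀ t), hL₁, fun t ht s => (hLf t ht s).trans (hf t ht s)⟩

/-- A tame cube can be contracted to a point. -/
theorem TameCube.exists_contraction {a : (Fin n → ℝ) → Z} (ha : TameCube a) :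
    ∃ C : (Fin (n + 1) → ℝ) → Z, TameCube C ∧ (∀ t, C (pt 0 t) = a t) ∧
      ∀ t, C (pt 1 t) = a 0 := by
  obtain ⟨ε, h₀, h₁, ha⟩ := ha
  -- Straight-line contraction towards the origin, then flattened.
  have hs : SmoothFrom fun x : Fin (n + 1) → ℝ => a ((1 - x 0) • Fin.tail x) :=
    ha.smooth.comp_contDiff ((contDiff_const.sub (contDiff_apply ℝ ℝ 0)).smul contDiff_tail)
  refine ⟨_, ⟨_, by linarith, by linarith, hs.isTameCube_flat h₀ h₁⟩, fun t => ?_, fun t => ?_⟩ <;>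
    rw [comp_pt] <;> simp only [Fin.cons_zero, Fin.tail_cons]
  · rw [flat_zero h₀ h₁, sub_zero, one_smul, ha.apply_flat h₀ h₁]
  · rw [flat_one h₀, sub_self, zero_smul]

end TameHomotopic

/-! ### Comparison with smooth homotopy classes -/

section HomotopyClasses

variable {Z W : Type*} [DiffeologicalSpace Z] [DiffeologicalSpace W] {n : ℕ}

/-- The point of the cube with given coordinates. -/
def cubePt (t : Fin n → ℝ) (ht : ∀ j, 0 ≤ t j ∧ t j ≤ 1) : cube n := ⟨WithLp.toLp 2 t, ht⟩

theorem cubePt_mem_cubeBoundary {t : Fin n → ℝ} (ht : ∀ j, 0 ≤ t j ∧ t j ≤ 1)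
    (ht' : t ∈ faces n) : (cubePt t ht).1 ∈ cubeBoundary n := ⟨ht, ht'⟩

theorem smoothFrom_comp_cubePt {E : Type*} [NormedAddCommGroup E] [NormedSpace ℝ E]
    {f : cube n → Z} (hf : DSmooth f) {r : E → Fin n → ℝ} (hr : ContDiff ℝ ∞ r)
    (h : ∀ x j, 0 ≤ r x j ∧ r x j ≤ 1) : SmoothFrom fun x => f (cubePt (r x) (h x)) :=
  fun m q hq => hf m (fun y => cubePt (r (q y)) (h _)) (isPlot_subtype_iff.2
    (ContDiff.isPlot (p := fun y => WithLp.toLp 2 (r (q y)))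
      (PiLp.contDiff_toLp.comp (hr.comp hq))))

theorem SmoothFrom.dSmooth_restrict {a : (Fin n → ℝ) → Z} (ha : SmoothFrom a) :
    DSmooth fun t : cube n => a t.1.ofLp :=
  fun m q hq => ha m (fun y => (q y).1.ofLp)
    (PiLp.contDiff_ofLp.comp (IsPlot.contDiff (isPlot_subtype_iff.1 hq)))

theorem SmoothFrom.dSmooth_restrict_prod {a : (Fin (n + 1) → ℝ) → Z} (ha : SmoothFrom a) :
    DSmooth fun x : cube n × unitInterval => a (pt (x.2 : ℝ) x.1.1.ofLp) := by
  intro m q hq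
  obtain ⟨h₁, h₂⟩ := isPlot_prod_iff.1 hq
  exact ha m (fun y => pt ((q y).2 : ℝ) (q y).1.1.ofLp)
    (contDiff_pt (IsPlot.contDiff (isPlot_subtype_iff.1 h₂))
      (PiLp.contDiff_ofLp.comp (IsPlot.contDiff (isPlot_subtype_iff.1 h₁))))

variable {ε : ℝ}

/-- The point of the cube with coordinates `flat ε (t j)`. -/
noncomputable def flatPt (h₀ : 0 < ε) (h₁ : ε < 1 / 2) (t : Fin n → ℝ) : cube n :=
  cubePt (flat ε ∘ t) fun _ => flat_mem h₀ h₁ _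

theorem flatPt_snap (h₀ : 0 < ε) (h₁ : ε < 1 / 2) (t : Fin n → ℝ) :
    flatPt h₀ h₁ (snap (ε / 2) ∘ t) = flatPt h₀ h₁ t := by
  simp only [flatPt, flat_comp_snap h₀ h₁]

theorem isTameCube_comp_flatPt (h₀ : 0 < ε) (h₁ : ε < 1 / 2) {f : cube n → Z} (hf : DSmooth f) :
    IsTameCube (ε / 2) fun t => f (flatPt h₀ h₁ t) where
  smooth := smoothFrom_comp_cubePt hf (contDiff_flat_comp ε) fun _ _ => flat_mem h₀ h₁ _
  tame t := by rw [flatPt_snap]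

theorem smoothFrom_comp_prodMk {E : Type*} [NormedAddCommGroup E] [NormedSpace ℝ E]
    {X : Type*} [DiffeologicalSpace X] {H : X × unitInterval → Z} (hH : DSmooth H) {f : E → X}
    (hf : SmoothFrom f) {σ : E → unitInterval} (hσ : ContDiff ℝ ∞ fun x => (σ x : ℝ)) :
    SmoothFrom fun x => H (f x, σ x) :=
  fun m q hq => hH m (fun y => (f (q y), σ (q y))) (isPlot_prod_iff.2 ⟨hf m q hq,
    isPlot_subtype_iff.2 (ContDiff.isPlot (p := fun y => (σ (q y) : ℝ)) (hσ.comp hq))⟩)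

/-- The function `flat ε` as a map into the unit interval. -/
noncomputable def flatI (h₀ : 0 < ε) (h₁ : ε < 1 / 2) (s : ℝ) : unitInterval :=
  ⟨flat ε s, flat_mem h₀ h₁ s⟩

theorem flatI_snap (h₀ : 0 < ε) (h₁ : ε < 1 / 2) (s : ℝ) :
    flatI h₀ h₁ (snap (ε / 2) s) = flatI h₀ h₁ s :=
  Subtype.ext (flat_snap h₀ h₁ s)

theorem flatI_zero (h₀ : 0 < ε) (h₁ : ε < 1 / 2) : flatI h₀ h₁ 0 = 0 :=
  Subtype.ext (flat_zero h₀ h₁)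

theorem flatI_one (h₀ : 0 < ε) (h₁ : ε < 1 / 2) : flatI h₀ h₁ 1 = 1 :=
  Subtype.ext (flat_one h₀)

theorem CubeMap.Homotopic.tameHomotopic (h₀ : 0 < ε) (h₁ : ε < 1 / 2) {x₀ : Z}
    {f g : CubeMap n Z x₀} (h : CubeMap.Homotopic f g) :
    TameHomotopic (fun t => f.1 (flatPt h₀ h₁ t)) fun t => g.1 (flatPt h₀ h₁ t) := by
  obtain ⟨H, hH, hH₀, hH₁, hHb⟩ := h
  have hb : ∀ t ∈ faces n, (flatPt h₀ h₁ t).1 ∈ cubeBoundary n := fun t ht =>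
    cubePt_mem_cubeBoundary _ (flat_mem_faces h₀ h₁ ht)
  refine ⟨fun x => H (flatPt h₀ h₁ (Fin.tail x), flatI h₀ h₁ (x 0)),
    ⟨ε / 2, by linarith, by linarith, ?_, fun x => ?_⟩, fun t => ?_, fun t => ?_, fun t ht s => ?_⟩
  · exact smoothFrom_comp_prodMk hH (smoothFrom_comp_cubePt dSmooth_id
      ((contDiff_flat_comp ε).comp contDiff_tail) fun _ _ => flat_mem h₀ h₁ _)
      ((contDiff_flat ε).comp (contDiff_apply ℝ ℝ 0))
  · exact congrArg H (Prod.ext (flatPt_snap h₀ h₁ (Fin.tail x)) (flatI_snap h₀ h₁ (x 0)))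
  · simp only [Fin.cons_zero, Fin.tail_cons, flatI_zero, hH₀]
  · simp only [Fin.cons_zero, Fin.tail_cons, flatI_one, hH₁]
  · simp only [Fin.tail_cons, hHb _ _ (hb t ht), f.2.2 _ (hb t ht)]

/-- Smooth homotopy is not assumed transitive, so equality of classes gives only a chain of
homotopies. Flattening turns each link into a tame homotopy, and these do compose. -/
theorem tameHomotopic_of_mk_eq (h₀ : 0 < ε) (h₁ : ε < 1 / 2) {x₀ : Z} {f g : CubeMap n Z x₀}
    (h : (Quot.mk _ f : HomotopyClasses n Z x₀) = Quot.mk _ g) :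
    TameHomotopic (fun t => f.1 (flatPt h₀ h₁ t)) fun t => g.1 (flatPt h₀ h₁ t) := by
  replace h := Quot.eqvGen_exact h
  induction h with
  | rel _ _ h => exact CubeMap.Homotopic.tameHomotopic h₀ h₁ h
  | refl f => exact .refl ⟨_, by linarith, by linarith, isTameCube_comp_flatPt h₀ h₁ f.2.1⟩
  | symm _ _ _ ih => exact ih.symm
  | trans _ _ _ _ _ ih ih' => exact ih.trans ih'

/-- The map of pairs given by a tame cube that is constant on the boundary. -/
def TameCube.toCubeMap {a : (Fin n → ℝ) → Z} (ha : TameCube a) {x₀ : Z}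
    (h : ∀ t ∈ faces n, a t = x₀) : CubeMap n Z x₀ :=
  ⟨fun t => a t.1.ofLp, by
    obtain ⟨_, _, _, ha⟩ := ha
    exact ha.smooth.dSmooth_restrict, fun t ht => h _ ht.2⟩

theorem TameHomotopic.homotopic {a b : (Fin n → ℝ) → Z} (h : TameHomotopic a b)
    (ha : TameCube a) (hb : TameCube b) {x₀ : Z} (hax : ∀ t ∈ faces n, a t = x₀)
    (hbx : ∀ t ∈ faces n, b t = x₀) :
    CubeMap.Homotopic (ha.toCubeMap hax) (hb.toCubeMap hbx) := by
  obtain ⟨K, ⟨_, _, _, hK⟩, h₀, h₁, hf⟩ := h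
  exact ⟨_, hK.smooth.dSmooth_restrict_prod, fun t => h₀ _, fun t => h₁ _,
    fun t s ht => (hf _ ht.2 _).trans (hax _ ht.2)⟩

/-- Only injectivity at the class of the constant cube is used. The cube `b` is recovered exactly at
the end because flattening fixes it. -/
theorem tameHomotopic_const_of_injective {p : Z → W} (hp : DSmooth p) {z : Z}
    (hinj : Function.Injective (HomotopyClasses.map hp n z)) {b : (Fin n → ℝ) → Z}
    (hb : TameCube b) (hbz : ∀ t ∈ faces n, b t = z)
    (h : TameHomotopic (fun _ => p z) fun t => p (b t)) : TameHomotopic (fun _ => z) b := by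
  have key : (Quot.mk _ ((tameCube_const z).toCubeMap fun _ _ => rfl) : HomotopyClasses n Z z) =
      Quot.mk _ (hb.toCubeMap hbz) :=
    hinj (Quot.sound (h.homotopic (tameCube_const _) (hb.dSmooth_comp hp) (fun _ _ => rfl)
      fun t ht => congrArg p (hbz t ht)))
  obtain ⟨ε, h₀, h₁, hb'⟩ := hb
  have := tameHomotopic_of_mk_eq h₀ h₁ key
  have e : (fun t => (TameCube.toCubeMap ⟨ε, h₀, h₁, hb'⟩ hbz).1 (flatPt h₀ h₁ t)) = b :=
    funext fun t => hb'.apply_flat h₀ h₁ t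
  rwa [e] at this

theorem exists_lift_of_surjective {p : Z → W} (hp : DSmooth p) {z : Z}
    (hsurj : Function.Surjective (HomotopyClasses.map hp n z)) {k : (Fin n → ℝ) → W}
    (hk : TameCube k) (hkz : ∀ t ∈ faces n, k t = p z) :
    ∃ v : (Fin n → ℝ) → Z, TameCube v ∧ (∀ t ∈ faces n, v t = z) ∧
      TameHomotopic (fun t => p (v t)) k := by
  obtain ⟨⟨f⟩, hf⟩ := hsurj (Quot.mk _ (hk.toCubeMap hkz))
  obtain ⟨ε, h₀, h₁, hk'⟩ := hk
  refine ⟨fun t => f.1 (flatPt h₀ h₁ t), ⟨_, by linarith, by linarith,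
    isTameCube_comp_flatPt h₀ h₁ f.2.1⟩, fun t ht => f.2.2 _ ?_, ?_⟩
  · exact cubePt_mem_cubeBoundary _ (flat_mem_faces h₀ h₁ ht)
  · have := tameHomotopic_of_mk_eq h₀ h₁ hf
    have e : (fun t => (TameCube.toCubeMap ⟨ε, h₀, h₁, hk'⟩ hkz).1 (flatPt h₀ h₁ t)) = k :=
      funext fun t => hk'.apply_flat h₀ h₁ t
    rwa [e] at this

end HomotopyClasses

/-! ### Lifting tame cubes along `N`-equivalences -/

section Lifting

variable {Y Z : Type*} [DiffeologicalSpace Y] [DiffeologicalSpace Z] {n N : ℕ} {p : Y → Z}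

/-- Injectivity on homotopy sets concerns cubes with constant boundary, so the common boundary is
first dragged to a point along a contraction `C` of `a`, with `D` carrying `b` along. There the
hypothesis makes the end of `D` null-homotopic, and the reversed tracks carry this homotopy back. -/
theorem TameHomotopic.of_comp (hp : IsNEquivalence N p) (hn : n < N) {a b : (Fin n → ℝ) → Y}
    (ha : TameCube a) (hb : TameCube b) (hab : ∀ t ∈ faces n, a t = b t)
    (h : TameHomotopic (fun t => p (a t)) fun t => p (b t)) : TameHomotopic a b := by
  obtain ⟨C, hC, hC₀, hC₁⟩ := ha.exists_contraction
  obtain ⟨ε, h₀, h₁, hC'⟩ := id hC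
  obtain ⟨D, hD, hD₀, hDf⟩ := exists_fill h₀ h₁ hC'.isTameSides hb fun t ht => by
    rw [hC₀, hab t ht]
  have h₁ : TameHomotopic (fun t => p (C (pt 1 t))) fun t => p (D (pt 1 t)) :=
    .transport (hC.dSmooth_comp hp.smooth) (hD.dSmooth_comp hp.smooth)
      (fun t ht s => by rw [hDf t ht]) (by simpa only [hC₀, hD₀] using h)
  simp only [hC₁] at h₁
  have h₂ := tameHomotopic_const_of_injective hp.smooth (hp.injective (a 0) n hn)
    (hD.face (.inr rfl)) (fun t ht => by rw [hDf t ht, hC₁]) h₁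
  have h₃ := TameHomotopic.transport hC.reflect hD.reflect
    (fun t ht s => by simp only [Fin.cons_zero, Fin.tail_cons]; rw [hDf t ht])
    (by simpa only [Fin.cons_zero, Fin.tail_cons, sub_zero, hC₁] using h₂)
  simpa only [Fin.cons_zero, Fin.tail_cons, sub_self, hC₀, hD₀] using h₃

/-- Boundary data in `Y` whose image in `Z` extends to the cube extend to the cube. -/
theorem exists_extension (hp : IsNEquivalence N p) (hn : n ≤ N) (hY : Nonempty Y) {ε : ℝ}
    (h₀ : 0 < ε) (h₁ : ε < 1 / 2) {h : (Fin n → ℝ) → Y} (hh : IsTameBoundary ε h)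
    {k : (Fin n → ℝ) → Z} (hk : TameCube k) (hkh : ∀ t ∈ faces n, k t = p (h t)) :
    ∃ w : (Fin n → ℝ) → Y, TameCube w ∧ ∀ t ∈ faces n, w t = h t := by
  cases n with
  | zero =>
    obtain ⟨y⟩ := hY
    -- A `0`-cube has no boundary, so any point of `Y` will do.
    exact ⟨_, tameCube_const y, fun t ⟨j, _⟩ => j.elim0⟩
  | succ m =>
    have hbot : TameCube fun t => h (pt 0 t) := ⟨ε, h₀, h₁, hh.isTameCube_face h₀ h₁ (.inl rfl)⟩
    have htop : TameCube fun t => h (pt 1 t) := ⟨ε, h₀, h₁, hh.isTameCube_face h₀ h₁ (.inr rfl)⟩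
    -- Fill all faces but the top one. The top of `w` and the prescribed top face share their
    -- boundary, and `k` shows that their images in `Z` are homotopic.
    obtain ⟨w, hw, hw₀, hwf⟩ := exists_fill h₀ h₁ hh.isTameSides hbot fun _ _ => rfl
    have hab : TameHomotopic (fun t => p (w (pt 1 t))) fun t => p (h (pt 1 t)) := by
      have := TameHomotopic.transport (hw.dSmooth_comp hp.smooth) hk
        (fun t ht s => by rw [hwf t ht, hkh _ (pt_mem_faces s ht)])
        (by
          simp only [hw₀, hkh _ (pt_zero_mem_faces _)]
          exact .refl (hbot.dSmooth_comp hp.smooth))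
      simpa only [hkh _ (pt_one_mem_faces _)] using this
    -- The top face has dimension `m` and `hn` reads `m < N`, so injectivity applies to it.
    obtain ⟨w', hw', hw'₀, hw'₁, hw'f⟩ := exists_replace_top hw
      (TameHomotopic.of_comp hp hn (hw.face (.inr rfl)) htop (fun t ht => hwf t ht 1) hab)
    refine ⟨w', hw', fun x hx => ?_⟩
    obtain ⟨s, t, rfl⟩ := exists_eq_pt x
    rcases pt_mem_faces_iff.1 hx with rfl | rfl | ht
    · rw [hw'₀, hw₀]
    · rw [hw'₁]
    · rw [hw'f t ht, hwf t ht]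

/-- Cubes in `Z` whose boundary lifts to `Y` lift to `Y` up to homotopy relative to the
boundary. -/
theorem exists_lift (hp : IsNEquivalence N p) (hn : n ≤ N) (hY : Nonempty Y) {ε : ℝ}
    (h₀ : 0 < ε) (h₁ : ε < 1 / 2) {h : (Fin n → ℝ) → Y} (hh : IsTameBoundary ε h)
    {k : (Fin n → ℝ) → Z} (hk : TameCube k) (hkh : ∀ t ∈ faces n, k t = p (h t)) :
    ∃ l : (Fin n → ℝ) → Y, TameCube l ∧ (∀ t ∈ faces n, l t = h t) ∧
      TameHomotopic k fun t => p (l t) := by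
  obtain ⟨w, hw, hwf⟩ := exists_extension hp hn hY h₀ h₁ hh hk hkh
  obtain ⟨C, hC, hC₀, hC₁⟩ := hw.exists_contraction
  obtain ⟨δ, hδ₀, hδ₁, hpC⟩ := hC.dSmooth_comp hp.smooth
  -- Contracting `w` drags the boundary of `k` to the point `p (w 0)`, so the top of `D` represents
  -- a class in `π_n`, which surjectivity lifts to `v`.
  obtain ⟨D, hD, hD₀, hDf⟩ := exists_fill hδ₀ hδ₁ hpC.isTameSides hk fun t ht => by
    rw [hC₀, hwf t ht, hkh t ht]
  obtain ⟨v, hv, hvf, hvD⟩ := exists_lift_of_surjective hp.smooth (hp.surjective (w 0) n hn)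
    (hD.face (.inr rfl)) (fun t ht => by rw [hDf t ht, hC₁])
  obtain ⟨η, hη₀, hη₁, hCr⟩ := hC.reflect
  -- Running the contraction backwards from `v` restores the boundary values `h`; the top of `E` is
  -- the lift.
  obtain ⟨E, hE, hE₀, hEf⟩ := exists_fill hη₀ hη₁ hCr.isTameSides hv fun t ht => by
    simp only [Fin.cons_zero, Fin.tail_cons]
    rw [sub_zero, hC₁, hvf t ht]
  simp only [Fin.cons_zero, Fin.tail_cons] at hEf
  refine ⟨_, hE.face (.inr rfl), fun t ht => ?_, ?_⟩
  · rw [hEf t ht, sub_self, hC₀, hwf t ht]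
  · have := TameHomotopic.transport (hE.dSmooth_comp hp.smooth) hD.reflect
      (fun t ht s => by
        simp only [Fin.cons_zero, Fin.tail_cons]
        rw [hDf t ht, hEf t ht])
      (by simpa only [Fin.cons_zero, Fin.tail_cons, sub_zero, hE₀] using hvD)
    simp only [Fin.cons_zero, Fin.tail_cons, sub_self, hD₀] at this
    exact this.symm

/-- The homotopy extension lifting property for tame maps on a cube and its boundary. -/
theorem exists_extension_lift (hp : IsNEquivalence N p) (hn : n ≤ N) (hY : Nonempty Y) {ε : ℝ}
    (h₀ : 0 < ε) (h₁ : ε < 1 / 2) {h : (Fin n → ℝ) → Y} (hh : IsTameBoundary ε h)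
    {k : (Fin n → ℝ) → Z} (hk : TameCube k) {S : (Fin (n + 1) → ℝ) → Z} (hS : IsTameSides ε S)
    (hS₀ : ∀ t ∈ faces n, S (pt 0 t) = k t) (hS₁ : ∀ t ∈ faces n, S (pt 1 t) = p (h t)) :
    ∃ (l : (Fin n → ℝ) → Y) (K : (Fin (n + 1) → ℝ) → Z), TameCube l ∧ TameCube K ∧
      (∀ t ∈ faces n, l t = h t) ∧ (∀ t, K (pt 0 t) = k t) ∧ (∀ t, K (pt 1 t) = p (l t)) ∧
      ∀ t ∈ faces n, ∀ s, K (pt s t) = S (pt s t) := by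
  -- Extend the homotopy first, lift its end up to a homotopy relative to the boundary, then absorb
  -- that homotopy into the top.
  obtain ⟨L, hL, hL₀, hLf⟩ := exists_fill h₀ h₁ hS hk hS₀
  obtain ⟨l, hl, hlf, hlL⟩ := exists_lift hp hn hY h₀ h₁ hh (hL.face (.inr rfl))
    fun t ht => by rw [hLf t ht, hS₁ t ht]
  obtain ⟨K, hK, hK₀, hK₁, hKf⟩ := exists_replace_top hL hlL
  exact ⟨l, K, hl, hK, hlf, fun t => (hK₀ t).trans (hL₀ t), hK₁,
    fun t ht s => (hKf t ht s).trans (hLf t ht s)⟩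

end Lifting

/-! ### Extension and lifting over a cell -/

section Cell

variable {X Y Z W : Type*} [DiffeologicalSpace X] [DiffeologicalSpace Y] [DiffeologicalSpace Z]
  {n N : ℕ} {δ ε : ℝ}

/-- Tameness moves one coordinate at a time, so the coordinates are snapped successively. The
intermediate points stay on the boundary because a coordinate equal to `0` or `1` keeps a value in
`{0, 1}` when snapped. -/
theorem IsEpsTame.apply_eq {V : Type*} {f : cubeBoundary n → V} (hf : IsEpsTame ε f) (hδ : δ ≤ ε)
    (hδ' : δ < 1 / 2) {t s : cubeBoundary n} (h : snap δ ∘ t.1.ofLp = snap δ ∘ s.1.ofLp) :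
    f t = f s := by
  classical
  have hmem : ∀ (t : cubeBoundary n) (A : Finset (Fin n)),
      WithLp.toLp 2 (A.piecewise (snap δ ∘ t.1.ofLp) t.1.ofLp) ∈ cubeBoundary n := by
    rintro ⟨t, ht, j, hj⟩ A
    refine ⟨fun i => ?_, j, ?_⟩
    · show 0 ≤ A.piecewise (snap δ ∘ t.ofLp) t.ofLp i ∧
        A.piecewise (snap δ ∘ t.ofLp) t.ofLp i ≤ 1
      by_cases hi : i ∈ A
      · rw [Finset.piecewise_eq_of_mem _ _ _ hi]
        show 0 ≤ snap δ (t i) ∧ snap δ (t i) ≤ 1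
        rcases snap_cases hδ' (t i) with ⟨_, e⟩ | ⟨_, e⟩ | ⟨_, _, e⟩ <;> rw [e]
        exacts [⟨le_rfl, zero_le_one⟩, ⟨zero_le_one, le_rfl⟩, ht i]
      · rw [Finset.piecewise_eq_of_notMem _ _ _ hi]
        exact ht i
    · show A.piecewise (snap δ ∘ t.ofLp) t.ofLp j = 0 ∨ A.piecewise (snap δ ∘ t.ofLp) t.ofLp j = 1
      by_cases hi : j ∈ A
      · rw [Finset.piecewise_eq_of_mem _ _ _ hi]
        show snap δ (t j) = 0 ∨ snap δ (t j) = 1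
        rcases snap_cases hδ' (t j) with ⟨_, e⟩ | ⟨_, e⟩ | ⟨_, _, e⟩ <;> rw [e]
        exacts [.inl rfl, .inr rfl, hj]
      · rw [Finset.piecewise_eq_of_notMem _ _ _ hi]
        exact hj
  have key : ∀ (t : cubeBoundary n) (A : Finset (Fin n)), f t = f ⟨_, hmem t A⟩ := by
    intro t A
    induction A using Finset.induction_on with
    | empty => congr 1
    | insert a A ha ih =>
      rw [ih]
      have hoff : ∀ k, k ≠ a → (insert a A).piecewise (snap δ ∘ t.1.ofLp) t.1.ofLp k =
          A.piecewise (snap δ ∘ t.1.ofLp) t.1.ofLp k := fun k hk => by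
        simp [Finset.piecewise_insert, Function.update_of_ne hk]
      have hA : A.piecewise (snap δ ∘ t.1.ofLp) t.1.ofLp a = t.1.ofLp a :=
        Finset.piecewise_eq_of_notMem _ _ _ ha
      have hA' : (insert a A).piecewise (snap δ ∘ t.1.ofLp) t.1.ofLp a = snap δ (t.1.ofLp a) :=
        Finset.piecewise_eq_of_mem _ _ _ (Finset.mem_insert_self _ _)
      have hc := t.2.1 a
      rcases snap_cases hδ' (t.1.ofLp a) with ⟨h, e⟩ | ⟨h, e⟩ | ⟨_, _, e⟩
      · refine hf a 0 (.inl rfl) _ _ ?_ (hA'.trans e) hoff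
        show |A.piecewise (snap δ ∘ t.1.ofLp) t.1.ofLp a - 0| ≤ ε
        rw [hA, abs_le]
        constructor <;> linarith
      · refine hf a 1 (.inr rfl) _ _ ?_ (hA'.trans e) hoff
        show |A.piecewise (snap δ ∘ t.1.ofLp) t.1.ofLp a - 1| ≤ ε
        rw [hA, abs_le]
        constructor <;> linarith
      · congr 1
        refine Subtype.ext (congrArg (WithLp.toLp 2) (funext fun k => ?_))
        by_cases hk : k = a
        · subst hk; rw [hA, hA', e]
        · exact (hoff k hk).symm
  rw [key t Finset.univ, key s Finset.univ]
  congr 1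
  refine Subtype.ext (congrArg (WithLp.toLp 2) ?_)
  rw [Finset.piecewise_univ, Finset.piecewise_univ, h]

theorem smoothFrom_subtype {E : Type*} [NormedAddCommGroup E] [NormedSpace ℝ E]
    {P : EuclideanSpace ℝ (Fin n) → Prop} {r : E → Fin n → ℝ} (hr : ContDiff ℝ ∞ r)
    (h : ∀ x, P (WithLp.toLp 2 (r x))) :
    SmoothFrom fun x => (⟨WithLp.toLp 2 (r x), h x⟩ : Subtype P) :=
  fun _ q hq => isPlot_subtype_iff.2 (ContDiff.isPlot (p := fun y => WithLp.toLp 2 (r (q y)))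
    (PiLp.contDiff_toLp.comp (hr.comp hq)))

open Classical in
/-- The extension of a map on the boundary of the cube, precomposed with `flat ε`. -/
noncomputable def extendBoundary (h₀ : 0 < ε) (h₁ : ε < 1 / 2) (h : cubeBoundary n → W) (w : W)
    (t : Fin n → ℝ) : W :=
  if ht : (flatPt h₀ h₁ t).1 ∈ cubeBoundary n then h ⟨_, ht⟩ else w

theorem extendBoundary_of_mem (h₀ : 0 < ε) (h₁ : ε < 1 / 2) (h : cubeBoundary n → W) (w : W)
    {t : Fin n → ℝ} (ht : flat ε ∘ t ∈ faces n) : extendBoundary h₀ h₁ h w t =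
      h ⟨_, cubePt_mem_cubeBoundary (fun j => flat_mem h₀ h₁ (t j)) ht⟩ :=
  dif_pos (cubePt_mem_cubeBoundary (fun j => flat_mem h₀ h₁ (t j)) ht)

theorem extendBoundary_snap (h₀ : 0 < ε) (h₁ : ε < 1 / 2) (h : cubeBoundary n → W) (w : W)
    (t : Fin n → ℝ) :
    extendBoundary h₀ h₁ h w (snap (ε / 2) ∘ t) = extendBoundary h₀ h₁ h w t := by
  rw [extendBoundary, extendBoundary, flatPt_snap h₀ h₁]

/-- A point and its flattening have the same image under `snap ε`, so tameness of `h` at a scale `δ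
≥ ε` cannot tell them apart. -/
theorem extendBoundary_eq (h₀ : 0 < ε) (h₁ : ε < 1 / 2) {h : cubeBoundary n → W} (hδ : ε ≤ δ)
    (hh : IsEpsTame δ h) (w : W) (t : cubeBoundary n) :
    extendBoundary h₀ h₁ h w t.1.ofLp = h t := by
  rw [extendBoundary_of_mem h₀ h₁ h w (flat_mem_faces h₀ h₁ t.2.2)]
  exact hh.apply_eq hδ h₁ (snap_comp_flat h₀ h₁ t.1.ofLp)

theorem isTameBoundary_extendBoundary [DiffeologicalSpace W] (h₀ : 0 < ε) (h₁ : ε < 1 / 2)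
    {h : cubeBoundary n → W}
    (hh : DSmooth h) (w : W) : IsTameBoundary (ε / 2) (extendBoundary h₀ h₁ h w) where
  smooth j α hα := by
    have hm : ∀ t : Fin n → ℝ, flat ε ∘ Function.update t j α ∈ faces n := fun t =>
      flat_mem_faces h₀ h₁ (update_mem_faces t j hα)
    simp only [extendBoundary_of_mem h₀ h₁ h w (hm _)]
    exact (smoothFrom_subtype ((contDiff_flat_comp ε).comp (contDiff_update j α)) _).dSmooth_comp hh
  tame t _ := extendBoundary_snap h₀ h₁ h w t

theorem isTameSides_extendBoundary [DiffeologicalSpace W] (h₀ : 0 < ε) (h₁ : ε < 1 / 2)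
    {H : cubeBoundary n × unitInterval → W} (hH : DSmooth H) (w : W) :
    IsTameSides (ε / 2) fun x : Fin (n + 1) → ℝ =>
      extendBoundary h₀ h₁ (fun t => H (t, flatI h₀ h₁ (x 0))) w (Fin.tail x) where
  smooth j α hα := by
    have hm : ∀ x : Fin (n + 1) → ℝ, flat ε ∘ Fin.tail (Function.update x j.succ α) ∈ faces n :=
      fun x => flat_mem_faces h₀ h₁ ⟨j, by simpa [Fin.tail] using hα⟩
    simp only [extendBoundary_of_mem h₀ h₁ _ w (hm _)]
    exact smoothFrom_comp_prodMk hH (smoothFrom_subtype ((contDiff_flat_comp ε).comp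
      (contDiff_tail.comp (contDiff_update j.succ α))) _)
      ((contDiff_flat ε).comp (contDiff_pi.1 (contDiff_update j.succ α) 0))
  tame s t _ := by
    simp only [Fin.cons_zero, Fin.tail_cons, flatI_snap, extendBoundary_snap]

theorem apply_eq_of_snap_eq {V : Type*} {F : unitInterval → V} (hδ : 0 ≤ δ) (hε : ε ≤ δ)
    (h₁ : ε < 1 / 2)
    (hF : ∀ t α : unitInterval, (α = 0 ∨ α = 1) → |(t : ℝ) - (α : ℝ)| ≤ δ → F t = F α)
    {s t : unitInterval} (h : snap ε s = snap ε t) : F s = F t := by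
  have key : ∀ s : unitInterval, ∃ t : unitInterval, (t : ℝ) = snap ε s ∧ F s = F t := by
    intro s
    rcases snap_cases h₁ s with ⟨h, e⟩ | ⟨h, e⟩ | ⟨_, _, e⟩
    · refine ⟨0, e.symm, hF _ _ (.inl rfl) ?_⟩
      rw [abs_le, Set.Icc.coe_zero]
      constructor <;> linarith [s.2.1]
    · refine ⟨1, e.symm, hF _ _ (.inr rfl) ?_⟩
      rw [abs_le, Set.Icc.coe_one]
      constructor <;> linarith [s.2.2]
    · exact ⟨s, e.symm, rfl⟩
  obtain ⟨s', hs, es⟩ := key s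
  obtain ⟨t', ht, et⟩ := key t
  rw [es, et, Subtype.ext ((hs.trans h).trans ht.symm)]

/-- Agreement on the whole strip `a < s ≤ b`, not just at `s = b`, makes the glued map locally equal
to one of the two pieces. -/
theorem dSmooth_glue {K₁ K₂ : X × unitInterval → Z} (h₁ : DSmooth K₁) (h₂ : DSmooth K₂)
    {a b : ℝ} (hab : a < b)
    (h : ∀ x (s : unitInterval), a < s → (s : ℝ) ≤ b → K₁ (x, s) = K₂ (x, s)) :
    DSmooth fun x : X × unitInterval => if (x.2 : ℝ) ≤ b then K₁ x else K₂ x := by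
  intro m q hq
  have hc : Continuous fun y => ((q y).2 : ℝ) :=
    (IsPlot.contDiff (isPlot_subtype_iff.1 (isPlot_prod_iff.1 hq).2)).continuous
  refine isPlot_of_eventuallyEq fun y => ?_
  rcases lt_or_ge ((q y).2 : ℝ) b with hy | hy
  · refine ⟨_, h₁ m q hq, ?_⟩
    filter_upwards [hc.continuousAt.eventually_lt_const hy] with x hx
    exact if_pos hx.le
  · refine ⟨_, h₂ m q hq, ?_⟩
    filter_upwards [hc.continuousAt.eventually_const_lt (hab.trans_le hy)] with x hx
    simp only [Function.comp_apply]
    split_ifs with hb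
    exacts [h _ _ hx hb, rfl]

/-- The segment from a point of the cube to its image under `flat ε`. -/
noncomputable def segmentPt (h₀ : 0 < ε) (h₁ : ε < 1 / 2) (t : cube n) (σ : unitInterval) :
    cube n :=
  cubePt (fun j => (1 - (σ : ℝ)) * t.1.ofLp j + σ * flat ε (t.1.ofLp j)) fun j => by
    have hf := flat_mem h₀ h₁ (t.1.ofLp j)
    have ht := t.2 j
    have hσ := σ.2
    constructor
    · nlinarith [mul_nonneg (sub_nonneg.2 hσ.2) ht.1, mul_nonneg hσ.1 hf.1]
    · nlinarith [mul_nonneg (sub_nonneg.2 hσ.2) (sub_nonneg.2 ht.2),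
        mul_nonneg hσ.1 (sub_nonneg.2 hf.2)]

theorem segmentPt_zero (h₀ : 0 < ε) (h₁ : ε < 1 / 2) (t : cube n) : segmentPt h₀ h₁ t 0 = t := by
  refine Subtype.ext (PiLp.ext fun j => ?_)
  show (1 - (0 : ℝ)) * t.1.ofLp j + 0 * flat ε (t.1.ofLp j) = t.1.ofLp j
  ring

theorem segmentPt_one (h₀ : 0 < ε) (h₁ : ε < 1 / 2) (t : cube n) :
    segmentPt h₀ h₁ t 1 = flatPt h₀ h₁ t.1.ofLp := by
  refine Subtype.ext (PiLp.ext fun j => ?_)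
  show (1 - (1 : ℝ)) * t.1.ofLp j + 1 * flat ε (t.1.ofLp j) = flat ε (t.1.ofLp j)
  ring

theorem snap_segmentPt (h₀ : 0 < ε) (h₁ : ε < 1 / 2) (t : cube n) (σ : unitInterval) :
    snap ε ∘ (segmentPt h₀ h₁ t σ).1.ofLp = snap ε ∘ t.1.ofLp :=
  funext fun j => snap_segment h₀ h₁ (t.1.ofLp j) σ.2.1 σ.2.2

theorem segmentPt_mem_cubeBoundary (h₀ : 0 < ε) (h₁ : ε < 1 / 2) {t : cube n}
    (ht : t.1 ∈ cubeBoundary n) (σ : unitInterval) :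
    (segmentPt h₀ h₁ t σ).1 ∈ cubeBoundary n := by
  refine ⟨(segmentPt h₀ h₁ t σ).2, ht.2.imp fun j hj => ?_⟩
  show (1 - (σ : ℝ)) * t.1 j + σ * flat ε (t.1 j) = 0 ∨
    (1 - (σ : ℝ)) * t.1 j + σ * flat ε (t.1 j) = 1
  rcases hj with hj | hj <;> rw [hj]
  · rw [flat_zero h₀ h₁]; left; ring
  · rw [flat_one h₀]; right; ring

theorem dSmooth_segmentPt (h₀ : 0 < ε) (h₁ : ε < 1 / 2) {σ : ℝ → unitInterval}
    (hσ : ContDiff ℝ ∞ fun s => (σ s : ℝ)) :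
    DSmooth fun x : cube n × unitInterval => segmentPt h₀ h₁ x.1 (σ x.2) := by
  intro m q hq
  obtain ⟨hq₁, hq₂⟩ := isPlot_prod_iff.1 hq
  have ht : ContDiff ℝ ∞ fun y => (q y).1.1.ofLp :=
    PiLp.contDiff_ofLp.comp (IsPlot.contDiff (isPlot_subtype_iff.1 hq₁))
  have hs : ContDiff ℝ ∞ fun y => (σ ((q y).2 : ℝ) : ℝ) :=
    hσ.comp (IsPlot.contDiff (isPlot_subtype_iff.1 hq₂))
  refine isPlot_subtype_iff.2 (ContDiff.isPlot (p := fun y => WithLp.toLp 2 fun j =>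
    (1 - (σ ((q y).2 : ℝ) : ℝ)) * (q y).1.1.ofLp j +
      (σ ((q y).2 : ℝ) : ℝ) * flat ε ((q y).1.1.ofLp j))
    (PiLp.contDiff_toLp.comp (contDiff_pi.2 fun j => ?_)))
  have hj := contDiff_pi.1 ht j
  exact ((contDiff_const.sub hs).mul hj).add (hs.mul ((contDiff_flat ε).comp hj))

/-- The homotopy extension lifting property for a cell, with a control on the tameness of the
homotopy that does not depend on the tameness of the data on the boundary of the cell. -/
theorem exists_cell_extension {p : Y → Z} (hp : IsNEquivalence N p) (hn : n ≤ N)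
    (hY : Nonempty Y) {q : cube n → Z} (hq : DSmooth q) {h : cubeBoundary n → Y}
    (hh : DSmooth h) {H : cubeBoundary n × unitInterval → Z} (hH : DSmooth H)
    (hε : 0 < ε) (hhε : IsEpsTame ε h) (hHε : ∀ s, IsEpsTame ε fun t => H (t, s))
    (hδ : 0 < δ) (hδ' : δ < 1 / 2)
    (hHδ : ∀ x, ∀ t α : unitInterval, (α = 0 ∨ α = 1) → |(t : ℝ) - (α : ℝ)| ≤ δ →
      H (x, t) = H (x, α))
    (hH₀ : ∀ t, H (t, 0) = q (Set.inclusion (cubeBoundary_subset n) t))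
    (hH₁ : ∀ t, H (t, 1) = p (h t)) :
    ∃ (k : cube n → Y) (K : cube n × unitInterval → Z), DSmooth k ∧ DSmooth K ∧
      (∀ t, k (Set.inclusion (cubeBoundary_subset n) t) = h t) ∧
      (∀ t s, K (Set.inclusion (cubeBoundary_subset n) t, s) = H (t, s)) ∧
      (∀ t, K (t, 0) = q t) ∧ (∀ t, K (t, 1) = p (k t)) ∧
      ∀ x, ∀ t α : unitInterval, (α = 0 ∨ α = 1) → |(t : ℝ) - (α : ℝ)| ≤ δ / 8 →
        K (x, t) = K (x, α) := by
  obtain ⟨y₀⟩ := id hY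
  -- One flattening scale serves space and time: `η ≤ ε` keeps the boundary data unchanged in the
  -- cube directions, `η ≤ δ` keeps `H` unchanged in time.
  obtain ⟨η, h₀, hηε, hηδ⟩ : ∃ η, 0 < η ∧ η ≤ ε ∧ η ≤ δ :=
    ⟨min ε δ, lt_min hε hδ, min_le_left _ _, min_le_right _ _⟩
  have h₁ : η < 1 / 2 := hηδ.trans_lt hδ'
  have hT : ∀ x, ∀ s t : unitInterval, snap η s = snap η t → H (x, s) = H (x, t) :=
    fun x s t => apply_eq_of_snap_eq (F := fun s => H (x, s)) hδ.le hηδ h₁ (hHδ x)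
  have hT' : ∀ x, ∀ s t : unitInterval, snap δ s = snap δ t → H (x, s) = H (x, t) :=
    fun x s t => apply_eq_of_snap_eq (F := fun s => H (x, s)) hδ.le le_rfl hδ' (hHδ x)
  have hface : ∀ {t : Fin n → ℝ}, t ∈ faces n → flat η ∘ t ∈ faces n := flat_mem_faces h₀ h₁
  -- The tame cube lifted here is `q` precomposed with `flat η`. The values `y₀` and `p y₀` are only
  -- defaults away from the faces.
  obtain ⟨l, K, ⟨_, _, _, hl⟩, ⟨_, _, _, hK⟩, hlf, hK₀, hK₁, hKf⟩ :=
    exists_extension_lift hp hn hY (half_pos h₀) (by linarith)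
      (isTameBoundary_extendBoundary h₀ h₁ hh y₀)
      ⟨_, half_pos h₀, by linarith, isTameCube_comp_flatPt h₀ h₁ hq⟩
      (isTameSides_extendBoundary h₀ h₁ hH (p y₀))
      (fun t ht => by
        simp only [Fin.cons_zero, Fin.tail_cons, flatI_zero]
        rw [extendBoundary_of_mem _ _ _ _ (hface ht), hH₀]
        rfl)
      (fun t ht => by
        simp only [Fin.cons_zero, Fin.tail_cons, flatI_one]
        rw [extendBoundary_of_mem _ _ _ _ (hface ht), hH₁,
          extendBoundary_of_mem _ _ _ _ (hface ht)])
  -- Schedule of the homotopy: at rest up to `δ / 8`, moving from `q` to its flattening until `δ /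
  -- 4`, at rest up to `δ / 2`, then `K` in the time `flat δ`. The constants involve `δ` only, never
  -- `ε`.
  let σ : ℝ → unitInterval := fun s => ⟨rise (δ / 4) s, rise_nonneg _ _, rise_le_one _ _⟩
  have hσ₀ : ∀ s, s ≤ δ / 8 → σ s = 0 := fun s hs =>
    Subtype.ext (rise_of_le (by linarith) (by linarith))
  have hσ₁ : ∀ s, δ / 4 ≤ s → σ s = 1 := fun s hs => Subtype.ext (rise_of_ge (by linarith) hs)
  have hKsm : DSmooth fun x : cube n × unitInterval => K (pt (flat δ x.2) x.1.1.ofLp) :=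
    (hK.smooth.comp_contDiff (contDiff_pt ((contDiff_flat δ).comp (contDiff_apply ℝ ℝ 0))
      contDiff_tail)).dSmooth_restrict_prod
  refine ⟨fun t => l t.1.ofLp, fun x => if (x.2 : ℝ) ≤ δ / 2 then q (segmentPt h₀ h₁ x.1 (σ x.2))
    else K (pt (flat δ x.2) x.1.1.ofLp), hl.smooth.dSmooth_restrict, ?_, fun t => ?_,
    fun t s => ?_, fun t => ?_, fun t => ?_, fun x t α hα ht => ?_⟩
  -- Between `δ / 4` and `δ / 2` both pieces equal the flattened `q`, since `flat δ` is still `0`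
  -- there.
  · refine dSmooth_glue (hq.comp (dSmooth_segmentPt h₀ h₁ (contDiff_rise (δ / 4)))) hKsm
      (by linarith : δ / 4 < δ / 2) fun x s hs hs' => ?_
    rw [Function.comp_apply, hσ₁ _ hs.le, segmentPt_one, flat_of_le hδ hδ' hs', hK₀]
  · rw [← extendBoundary_eq h₀ h₁ hηε hhε y₀ t]
    exact hlf _ t.2.2
  · dsimp only
    split_ifs with hs
    · have hm := segmentPt_mem_cubeBoundary h₀ h₁
        (t := Set.inclusion (cubeBoundary_subset n) t) t.2 (σ s)
      -- Up to time `δ / 2` the homotopy `H` is at its start, which is `q` on the boundary. Tameness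
      -- of `H` at time `0` makes the segment deformation constant there.
      rw [hHδ t s 0 (.inl rfl) (by
        rw [abs_le, Set.Icc.coe_zero]; constructor <;> linarith [s.2.1])]
      have := hH₀ ⟨_, hm⟩
      refine this.symm.trans ?_
      exact (hHε 0).apply_eq hηε h₁ (snap_segmentPt h₀ h₁ _ _)
    · refine (hKf _ t.2.2 _).trans ?_
      simp only [Fin.cons_zero, Fin.tail_cons]
      refine (extendBoundary_eq h₀ h₁ hηε (hHε _) (p y₀) t).trans ?_
      -- Time has been flattened twice, at scale `δ` and then at scale `η`; stationarity of `H`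
      -- undoes each.
      exact (hT t _ (flatI hδ hδ' s) (snap_flat h₀ h₁ _)).trans (hT' t _ _ (snap_flat hδ hδ' _))
  · simp only [Set.Icc.coe_zero]
    rw [if_pos (by linarith), hσ₀ _ (by linarith), segmentPt_zero]
  · simp only [Set.Icc.coe_one]
    rw [if_neg (by linarith), flat_one hδ, hK₁]
  · rw [abs_le] at ht
    rcases hα with rfl | rfl
    · rw [Set.Icc.coe_zero] at ht
      simp only [Set.Icc.coe_zero]
      rw [if_pos (by linarith), if_pos (by linarith), hσ₀ _ (by linarith), hσ₀ _ (by linarith)]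
    · rw [Set.Icc.coe_one] at ht
      simp only [Set.Icc.coe_one]
      rw [if_neg (by linarith), if_neg (by linarith), flat_one hδ, flat_of_ge hδ (by linarith)]

end Cell

/-! ### Smooth maps out of pushouts -/

theorem coinduced_le_iff {X Y : Type*} {f : X → Y} {d : DiffeologicalSpace X}
    {D : DiffeologicalSpace Y} : coinduced f d ≤ D ↔ DSmooth f := by
  rw [DiffeologicalSpace.generateFrom_le_iff]
  constructor
  · intro h n p hp
    exact h n _ ⟨n, p, hp, rfl⟩
  · rintro h n p ⟨m, q, hq, e⟩
    obtain ⟨rfl, e⟩ := Sigma.mk.inj e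
    exact eq_of_heq e ▸ h n q hq

theorem dSmooth_sigma {ι : Type*} {X : ι → Type*} {Y : Type*} [∀ i, DiffeologicalSpace (X i)]
    [DiffeologicalSpace Y] {f : (Σ i, X i) → Y} (h : ∀ i, DSmooth fun x => f ⟨i, x⟩) :
    DSmooth f := by
  have : (instSigma : DiffeologicalSpace (Σ i, X i)) ≤ induced f inferInstance :=
    iSup_le fun i => coinduced_le_iff.2 (h i)
  exact fun n p hp => DiffeologicalSpace.le_iff'.1 this n p hp

/-- The diffeology on `X` whose plots are the maps `p` such that `w (p x, s)` depends smoothly on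
`x` and `s`. -/
abbrev parametrized {X S Z : Type*} [DiffeologicalSpace S] [DiffeologicalSpace Z] (w : X × S → Z)
    (hw : ∀ x, DSmooth fun s => w (x, s)) : DiffeologicalSpace X where
  plots n := {p | ∀ (m : ℕ) (r : EuclideanSpace ℝ (Fin m) → EuclideanSpace ℝ (Fin n))
    (τ : EuclideanSpace ℝ (Fin m) → S), ContDiff ℝ ∞ r → IsPlot τ →
      IsPlot fun y => w (p (r y), τ y)}
  constant_plots x := fun m _ τ _ hτ => hw x m τ hτ
  plot_reparam hp hf := fun m r τ hr hτ => hp m _ τ (hf.comp hr) hτ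
  locality {n p} hp := by
    intro m r τ hr hτ
    refine DiffeologicalSpace.locality fun y => ?_
    obtain ⟨U, hU, hyU, h⟩ := hp (r y)
    exact ⟨r ⁻¹' U, hU.preimage hr.continuous, hyU, fun {k f} hfU hf =>
      h (f := r ∘ f) hfU (hr.comp hf) k id (τ ∘ f) contDiff_id (isPlot_reparam hτ hf)⟩

namespace IsPushoutSquare

variable {S B T P : Type*} [DiffeologicalSpace S] [DiffeologicalSpace B] [DiffeologicalSpace T]
  [dP : DiffeologicalSpace P] {f : S → B} {i : S → T} {j : B → P} {g : T → P}

theorem comm (h : IsPushoutSquare f i j g) (s : S) : j (f s) = g (i s) := by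
  obtain ⟨-, -, e, -, hj, hg⟩ := h
  rw [← hj, ← hg, Quot.sound (PushoutRel.glue s)]

theorem surjective (h : IsPushoutSquare f i j g) (x : P) : (∃ b, j b = x) ∨ ∃ t, g t = x := by
  obtain ⟨-, -, e, -, hj, hg⟩ := h
  obtain ⟨⟨b | t⟩, rfl⟩ := e.surjective x
  · exact .inl ⟨b, (hj b).symm⟩
  · exact .inr ⟨t, (hg t).symm⟩

theorem exists_desc (h : IsPushoutSquare f i j g) {V : Type*} (u : B → V) (v : T → V)
    (huv : ∀ s, u (f s) = v (i s)) :
    ∃ w : P → V, (∀ b, w (j b) = u b) ∧ ∀ t, w (g t) = v t := by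
  obtain ⟨-, -, e, -, hj, hg⟩ := h
  have hr : ∀ x y, PushoutRel f i x y → Sum.elim u v x = Sum.elim u v y := by
    rintro _ _ ⟨s⟩
    exact huv s
  refine ⟨fun x => Quot.lift (Sum.elim u v) hr (e.symm x), fun b => ?_, fun t => ?_⟩ <;>
    dsimp only
  · rw [← hj, e.symm_apply_apply]; rfl
  · rw [← hg, e.symm_apply_apply]; rfl

/-- The pushout carries the finest diffeology making both legs smooth. Stated for an arbitrary `D`,
this allows `D` to be tailored to the map under study. -/
theorem le (h : IsPushoutSquare f i j g) {D : DiffeologicalSpace P} (hj : @DSmooth B P _ D j)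
    (hg : @DSmooth T P _ D g) : dP ≤ D := by
  obtain ⟨-, -, e, he, ej, eg⟩ := h
  have h₁ : (instSum : DiffeologicalSpace (B ⊕ T)) ≤
      induced (fun x => e (Quot.mk _ x)) D := by
    refine sup_le (coinduced_le_iff.2 ?_) (coinduced_le_iff.2 ?_)
    · intro n p hp
      have := hj n p hp
      rwa [← funext ej] at this
    · intro n p hp
      have := hg n p hp
      rwa [← funext eg] at this
  have h₂ : (instQuot : DiffeologicalSpace (Pushout f i)) ≤ induced e D :=
    coinduced_le_iff.2 (DiffeologicalSpace.le_iff'.1 h₁)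
  refine DiffeologicalSpace.le_iff'.2 fun n p hp => ?_
  have : @IsPlot _ D _ (e ∘ e.symm ∘ p) := DiffeologicalSpace.le_iff'.1 h₂ n _ (he.2 n p hp)
  rwa [← Function.comp_assoc, e.self_comp_symm, Function.id_comp] at this

variable {Z R : Type*} [DiffeologicalSpace Z] [DiffeologicalSpace R]

theorem dSmooth (h : IsPushoutSquare f i j g) {w : P → Z} (hj : DSmooth fun b => w (j b))
    (hg : DSmooth fun t => w (g t)) : DSmooth w :=
  DiffeologicalSpace.le_iff'.1 (h.le (D := induced w inferInstance) hj hg)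

/-- Products preserve pushouts of diffeological spaces, by cartesian closedness. Instead of a
function space, the universal property is applied to the diffeology `parametrized w hc` on `P`,
which encodes joint smoothness with the parameter; evaluating at the identity reparametrization
recovers `w`. -/
theorem dSmooth_prod (h : IsPushoutSquare f i j g) {w : P × R → Z}
    (hj : DSmooth fun x : B × R => w (j x.1, x.2)) (hg : DSmooth fun x : T × R => w (g x.1, x.2)) :
    DSmooth w := by
  have hc : ∀ x, DSmooth fun s => w (x, s) := by
    intro x
    rcases h.surjective x with ⟨b, rfl⟩ | ⟨t, rfl⟩
    · exact hj.comp (dSmooth_prodMk dSmooth_const dSmooth_id)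
    · exact hg.comp (dSmooth_prodMk dSmooth_const dSmooth_id)
  have hle : dP ≤ parametrized w hc := h.le
    (fun n p hp m r τ hr hτ => hj m (fun y => (p (r y), τ y))
      (isPlot_prod_iff.2 ⟨isPlot_reparam hp hr, hτ⟩))
    (fun n p hp m r τ hr hτ => hg m (fun y => (p (r y), τ y))
      (isPlot_prod_iff.2 ⟨isPlot_reparam hp hr, hτ⟩))
  intro n q hq
  obtain ⟨hq₁, hq₂⟩ := isPlot_prod_iff.1 hq
  exact DiffeologicalSpace.le_iff'.1 hle n _ hq₁ n id _ contDiff_id hq₂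

end IsPushoutSquare

theorem dSmooth_sigma_prod {ι : Type*} {X : ι → Type*} {R Z : Type*}
    [∀ i, DiffeologicalSpace (X i)] [DiffeologicalSpace R] [DiffeologicalSpace Z]
    {w : (Σ i, X i) × R → Z} (h : ∀ i, DSmooth fun x : X i × R => w (⟨i, x.1⟩, x.2)) :
    DSmooth w := by
  have hc : ∀ x, DSmooth fun s => w (x, s) := fun ⟨i, x⟩ =>
    (h i).comp (dSmooth_prodMk (dSmooth_const (y := x)) dSmooth_id)
  have hle : (instSigma : DiffeologicalSpace (Σ i, X i)) ≤ parametrized w hc :=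
    iSup_le fun i => coinduced_le_iff.2 fun n p hp m r τ hr hτ => h i m (fun y => (p (r y), τ y))
      (isPlot_prod_iff.2 ⟨isPlot_reparam hp hr, hτ⟩)
  intro n q hq
  obtain ⟨hq₁, hq₂⟩ := isPlot_prod_iff.1 hq
  exact DiffeologicalSpace.le_iff'.1 hle n _ hq₁ n id _ contDiff_id hq₂

/-! ### Extension over the skeleta -/

section Skeleta

variable {X : Type u} {Y : Type v} {Z : Type w} [DiffeologicalSpace X] [DiffeologicalSpace Y]
  [DiffeologicalSpace Z] {A : Set X}

/-- Constancy of a homotopy at distance at most `δ` from the ends of the unit interval. -/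
def IsStationary {V W : Type*} (δ : ℝ) (G : V × unitInterval → W) : Prop :=
  ∀ (x : V) (t α : unitInterval), (α = 0 ∨ α = 1) → |(t : ℝ) - (α : ℝ)| ≤ δ → G (x, t) = G (x, α)

theorem RelCWComplex.char_inclusion (C : RelCWComplex.{u, c} X A) (n : ℕ) (l : C.cell n)
    (t : cubeBoundary n) :
    C.char n l (Set.inclusion (cubeBoundary_subset n) t) =
      Set.inclusion (C.skel_subset n) (C.attach n l t) :=
  ((C.isPushout n).comm ⟨l, t⟩).symm

theorem dSmooth_sigmaMk {ι : Type*} {X : ι → Type*} [∀ i, DiffeologicalSpace (X i)] (i : ι) :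
    DSmooth (Sigma.mk i : X i → Σ i, X i) :=
  coinduced_le_iff.1 (le_iSup (fun i => coinduced (Sigma.mk i) (inferInstance :
    DiffeologicalSpace (X i))) i)

theorem IsPushoutSquare.dSmooth_right {S B T P : Type*} [DiffeologicalSpace S]
    [DiffeologicalSpace B] [DiffeologicalSpace T] [DiffeologicalSpace P] {f : S → B} {i : S → T}
    {j : B → P} {g : T → P} (h : IsPushoutSquare f i j g) : DSmooth g := by
  obtain ⟨-, -, e, he, -, hg⟩ := h
  have h₁ : DSmooth (Sum.inr : T → B ⊕ T) := coinduced_le_iff.1 le_sup_right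
  have h₂ : DSmooth (Quot.mk (PushoutRel f i)) := coinduced_le_iff.1 le_rfl
  have := he.1.comp (h₂.comp h₁)
  rwa [← funext hg]

theorem RelCWComplex.dSmooth_char (C : RelCWComplex.{u, c} X A) (n : ℕ) (l : C.cell n) :
    DSmooth (C.char n l) :=
  (C.isPushout n).dSmooth_right.comp (dSmooth_sigmaMk (X := fun _ : C.cell n => cube n) l)

/-- The homotopy extension lifting property for a skeleton and the next one. -/
theorem RelCWComplex.exists_skel_extension (C : RelCWComplex.{u, c} X A)
    (hC : C.IsGathered) {N n : ℕ} (hn : n ≤ N) {p : Y → Z} (hp : IsNEquivalence N p)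
    (hne : Nonempty Z → Nonempty Y) {g : X → Z} (hg : DSmooth g) {f : C.skel n → Y}
    (hf : DSmooth f) {G : C.skel n × unitInterval → Z} (hG : DSmooth G) {δ : ℝ} (hδ : 0 < δ)
    (hδ' : δ < 1 / 2) (hGδ : IsStationary δ G) (hG₀ : ∀ x, G (x, 0) = g x)
    (hG₁ : ∀ x, G (x, 1) = p (f x)) :
    ∃ (f₁ : C.skel (n + 1) → Y) (G₁ : C.skel (n + 1) × unitInterval → Z), DSmooth f₁ ∧
      DSmooth G₁ ∧ IsStationary (δ / 8) G₁ ∧ (∀ x, G₁ (x, 0) = g x) ∧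
      (∀ x, G₁ (x, 1) = p (f₁ x)) ∧ (∀ x, f₁ (Set.inclusion (C.skel_subset n) x) = f x) ∧
      ∀ x s, G₁ (Set.inclusion (C.skel_subset n) x, s) = G (x, s) := by
  have hcell : ∀ l : C.cell n, ∃ (k : cube n → Y) (K : cube n × unitInterval → Z),
      DSmooth k ∧ DSmooth K ∧
      (∀ t, k (Set.inclusion (cubeBoundary_subset n) t) = f (C.attach n l t)) ∧
      (∀ t s, K (Set.inclusion (cubeBoundary_subset n) t, s) = G (C.attach n l t, s)) ∧
      (∀ t, K (t, 0) = g (C.char n l t)) ∧ (∀ t, K (t, 1) = p (k t)) ∧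
      IsStationary (δ / 8) K := by
    intro l
    obtain ⟨hφ, ε, hε, -, hφε⟩ := hC n l
    -- A cell provides a point of `Z`, hence `Y` is nonempty as soon as there is something to extend
    -- over.
    refine exists_cell_extension hp hn (hne ⟨g (C.char n l (cubePt 0 fun j => by simp))⟩)
      (hg.comp (dSmooth_subtype_val.comp (C.dSmooth_char n l))) (hf.comp hφ)
      (H := fun x => G (C.attach n l x.1, x.2))
      (hG.comp (dSmooth_prodMk (hφ.comp dSmooth_fst) dSmooth_snd)) hε
      (fun j α hα t s h₁ h₂ h₃ => congrArg f (hφε j α hα t s h₁ h₂ h₃))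
      (fun r j α hα t s h₁ h₂ h₃ => congrArg (fun x => G (x, r)) (hφε j α hα t s h₁ h₂ h₃))
      hδ hδ' (fun x => hGδ (C.attach n l x)) (fun t => ?_) (fun t => hG₁ _)
    rw [hG₀, Function.comp_apply, Function.comp_apply, C.char_inclusion]
  choose k K hk hK hkf hKG hK₀ hK₁ hKδ using hcell
  have hP := C.isPushout n
  obtain ⟨f₁, hf₁, hf₁k⟩ := hP.exists_desc f (fun x => k x.1 x.2) fun ⟨l, t⟩ => (hkf l t).symm
  -- The homotopy is descended in curried form, since the pushout is in the space variable only.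
  obtain ⟨G₁, hG₁', hG₁K⟩ := hP.exists_desc (fun x s => G (x, s)) (fun x s => K x.1 (x.2, s))
    fun ⟨l, t⟩ => funext fun s => (hKG l t s).symm
  refine ⟨f₁, fun x => G₁ x.1 x.2, hP.dSmooth ?_ ?_, hP.dSmooth_prod ?_ ?_, fun x t α hα ht => ?_,
    fun x => ?_, fun x => ?_, hf₁, fun x s => congrFun (hG₁' x) s⟩
  · simpa only [hf₁] using hf
  · simp only [hf₁k]
    exact dSmooth_sigma hk
  · simpa only [hG₁'] using hG
  · simp only [hG₁K]
    exact dSmooth_sigma_prod hK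
  · rcases hP.surjective x with ⟨b, rfl⟩ | ⟨t', rfl⟩
    · simp only [hG₁']
      exact hGδ b t α hα (ht.trans (by linarith))
    · simp only [hG₁K]
      exact hKδ _ _ t α hα ht
  · rcases hP.surjective x with ⟨b, rfl⟩ | ⟨t', rfl⟩
    · simp only [hG₁', hG₀]
    · simp only [hG₁K, hK₀]
  · rcases hP.surjective x with ⟨b, rfl⟩ | ⟨t', rfl⟩
    · simp only [hG₁', hG₁, hf₁]
    · simp only [hG₁K, hK₁, hf₁k]

theorem RelCWComplex.subset_skel (C : RelCWComplex.{u, c} X A) (n : ℕ) : A ⊆ C.skel n := by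
  induction n with
  | zero => exact C.skel_zero.ge
  | succ n ih => exact ih.trans (C.skel_subset n)

/-- Each dimension divides the collar `δ` by `8`, so it remains positive at every finite stage.
Passing to `skel (n + 1)` attaches `n`-cells, so the bound `N + 1` uses cells of dimension at most
`N`. -/
theorem RelCWComplex.exists_extension_skel (C : RelCWComplex.{u, c} X A)
    (hC : C.IsGathered) {N : ℕ} {p : Y → Z} (hp : IsNEquivalence N p)
    (hne : Nonempty Z → Nonempty Y) {g : X → Z} (hg : DSmooth g) {f' : A → Y} (hf' : DSmooth f')
    {F' : A × unitInterval → Z} (hF' : IsTameHomotopy F') (hF'₀ : ∀ a : A, F' (a, 0) = g a)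
    (hF'₁ : ∀ a : A, F' (a, 1) = p (f' a)) (n : ℕ) (hn : n ≤ N + 1) :
    ∃ (f : C.skel n → Y) (G : C.skel n × unitInterval → Z) (δ : ℝ), DSmooth f ∧ DSmooth G ∧
      0 < δ ∧ δ < 1 / 2 ∧ IsStationary δ G ∧ (∀ x, G (x, 0) = g x) ∧ (∀ x, G (x, 1) = p (f x)) ∧
      (∀ a, f (Set.inclusion (C.subset_skel n) a) = f' a) ∧
      ∀ a s, G (Set.inclusion (C.subset_skel n) a, s) = F' (a, s) := by
  induction n with
  | zero =>
    obtain ⟨hF, ε, hε, -, hFε⟩ := hF'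
    have hi := dSmooth_inclusion C.skel_zero.le
    -- The collar of a tame homotopy may equal `1 / 2`; the minimum with `1 / 4` makes it strictly
    -- smaller, as `flat` and `snap` require.
    refine ⟨fun x => f' (Set.inclusion C.skel_zero.le x),
      fun x => F' (Set.inclusion C.skel_zero.le x.1, x.2), min ε (1 / 4), hf'.comp hi,
      hF.comp (dSmooth_prodMk (hi.comp dSmooth_fst) dSmooth_snd), lt_min hε (by norm_num),
      (min_le_right _ _).trans_lt (by norm_num),
      fun x t α hα ht => hFε _ t α hα (ht.trans (min_le_left _ _)), fun x => hF'₀ _,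
      fun x => hF'₁ _, fun a => rfl, fun a s => rfl⟩
  | succ n ih =>
    obtain ⟨f, G, δ, hf, hG, hδ, hδ', hGδ, hG₀, hG₁, hfA, hGA⟩ := ih (by omega)
    obtain ⟨f₁, G₁, hf₁, hG₁', hGδ₁, h₀, h₁, hff, hGG⟩ := C.exists_skel_extension hC
      (Nat.le_of_succ_le_succ hn) hp hne hg hf hG hδ hδ' hGδ hG₀ hG₁
    exact ⟨f₁, G₁, δ / 8, hf₁, hG₁', by linarith, by linarith, hGδ₁, h₀, h₁,
      fun a => (hff _).trans (hfA a), fun a s => (hGG _ s).trans (hGA a s)⟩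

end Skeleta

end SmoothCW

theorem mainTheorem1
    {X : Type u} {Y : Type v} {Z : Type w}
    [DiffeologicalSpace X] [DiffeologicalSpace Y] [DiffeologicalSpace Z]
    {A : Set X} (N : ℕ)
    (C : SmoothCW.RelCWComplex.{u, c} X A) (hgathered : C.IsGathered) (hdim : C.DimLE N)
    (p : Y → Z) (hp : SmoothCW.IsNEquivalence N p) (hne : Nonempty Z → Nonempty Y)
    (f' : A → Y) (hf' : DSmooth f') (g : X → Z) (hg : DSmooth g)
    (F' : A × unitInterval → Z) (hF' : SmoothCW.IsTameHomotopy F')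
    (hF'_zero : ∀ a : A, F' (a, 0) = g a)
    (hF'_one : ∀ a : A, F' (a, 1) = p (f' a)) :
    ∃ (f : X → Y) (G : X × unitInterval → Z),
      DSmooth f ∧ SmoothCW.IsTameHomotopy G ∧
      (∀ a : A, f a = f' a) ∧
      (∀ (a : A) (t : unitInterval), G ((a : X), t) = F' (a, t)) ∧
      (∀ x : X, G (x, 0) = g x) ∧
      (∀ x : X, G (x, 1) = p (f x)) := by
  obtain ⟨f, G, δ, hf, hG, hδ, hδ', hGδ, hG₀, hG₁, hfA, hGA⟩ :=
    C.exists_extension_skel hgathered hp hne hg hf' hF' hF'_zero hF'_one (N + 1) le_rfl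
  -- In the shifted indexing `skel (N + 1)` is the `N`-skeleton, which is all of `X`; the colimit
  -- condition is not needed.
  have hmem : ∀ x, x ∈ C.skel (N + 1) := fun x => hdim ▸ Set.mem_univ x
  let i : X → C.skel (N + 1) := fun x => ⟨x, hmem x⟩
  have hi : DSmooth i := fun _ _ h => h
  exact ⟨fun x => f (i x), fun x => G (i x.1, x.2), hf.comp hi,
    ⟨hG.comp (SmoothCW.dSmooth_prodMk (hi.comp SmoothCW.dSmooth_fst) SmoothCW.dSmooth_snd),
      δ, hδ, hδ'.le, fun x t α hα ht => hGδ _ t α hα ht⟩,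
    hfA, hGA, fun x => hG₀ _, fun x => hG₁ _⟩
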